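/- Let $(\Omega,d)$ be a compact metric space with at least two points, $\Sigma=\Omega^{\mathbb N}$ the space of strings with the product topology, and $T:\Sigma\to\Sigma$, $T(\sigma)_n=\sigma_{n+1}$, the shift. Let $\mathcal P(T)\subseteq C(\Sigma)^*$ be the convex set of $T$-invariant Borel probability measures on $\Sigma$ with the weak$^*$ topology, where $C(\Sigma)=C(\Sigma;\mathbb R)$ carries the supremum norm, and let $\mathcal P_{\rm erg}(T)\subseteq\mathcal P(T)$ be the subset of ergodic measures. Let $S$ be the closed unit ball of $C(\Sigma)$ with the uniform metric and $\mathcal M(S)$ the space of bounded Borel-measurable functions $S\to\mathbb R$. For $\mu\in\mathcal P(T)$ define $\mu_S\in\mathcal M(S)$ by $\mu_S(\varphi)=\int_\Sigma\varphi\,d\mu$. A function $F:\mathcal M(S)\to\mathbb R$ is called $\sigma$-normal if $F(f_n)\to F(f)$ whenever $(f_n)_n\subseteq\mathcal M(S)$ is a uniformly bounded sequence converging pointwise to $f\in\mathcal M(S)$. For every $\mu\in\mathcal P(T)$ there is a unique Borel probability measure $\xi_\mu$ on $\mathcal P(T)$ (the Choquet measure of $\mu$) with $\xi_\mu(\mathcal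 P(T)\setminus\mathcal P_{\rm erg}(T))=0$ and barycenter $\mu$, i.e. $\int_\Sigma\varphi\,d\mu=\int_{\mathcal P(T)}\big(\int_\Sigma\varphi\,d\nu\big)\,\xi_\mu(d\nu)$ for all $\varphi\in C(\Sigma)$. For $F:\mathcal M(S)\to\mathbb R$ convex and $\sigma$-normal, set $$\Delta^F(\mu)=\int_{\mathcal P_{\rm erg}(T)}F(\nu_S)\,\xi_\mu(d\nu),\qquad \mu\in\mathcal P(T).$$ For $f:\mathcal P(T)\to(-\infty,\infty]$, its $\Gamma$-regularization is $\Gamma(f)(\mu)=\sup\{m(\mu): m \text{ an affine weak}^*\text{-continuous functional on } C(\Sigma)^* \text{ with } m|_{\mathcal P(T)}\le f\}$, $\mu\in\mathcal P(T)$. **Theorem (Properties of the functional $\Delta^F$).** Let $F:\mathcal M(S)\to\mathbb R$ be convex and $\sigma$-normal. Then: (i) $\Delta^F$ is affine and weak$^*$-upper semicontinuous. (ii) $\Delta^F$ is weak$^*$-continuous if and only if $\mu\mapsto F(\mu_S)$ is affine on $\mathcal P(T)$. In this case there is $f\in C(\Sigma)$ such that $\Delta^F(\mu)=\int_\Sigma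 f\,d\mu$ for all $\mu\in\mathcal P(T)$. (iii) If $\mu\mapsto F(\mu_S)$ is strictly convex on $\mathcal P(T)$, then the set of points at which $\Delta^F$ is weak$^*$-discontinuous is weak$^*$-dense in $\mathcal P(T)$. (iv) $\mathcal P_{\rm erg}(T)$ is a weak$^*$-dense $G_\delta$ subset of $\mathcal P(T)$, and $\Delta^F$ is weak$^*$-continuous at every point of it. In particular, the set of $\mu\in\mathcal P(T)$ at which $\Delta^F$ is weak$^*$-discontinuous is weak$^*$-meager. (v) The mapping $\mu\mapsto F(\mu_S)$ is weak$^*$-continuous and convex on $\mathcal P(T)$, and $\Gamma(\Delta^F)(\mu)=F(\mu_S)$ for all $\mu\in\mathcal P(T)$. -/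

import Mathlib

open MeasureTheory Set Filter Topology

noncomputable section

namespace DeltaFunctional

/-- The space `Σ = Ω^ℕ` of infinite strings over the alphabet `Ω`; as a plain product it carries
the product topology and the product (here: Borel) σ-algebra. -/
abbrev Strings (Ω : Type*) : Type _ := ℕ → Ω

/-- The shift `T` on strings: `T(σ)ₙ = σₙ₊₁`. -/
def shift (Ω : Type*) : Strings Ω → Strings Ω := fun σ n => σ (n + 1)

section Ball

variable (Ω : Type*) [TopologicalSpace Ω] [CompactSpace Ω]

/-- `S`: the closed unit ball of the Banach space `C(Σ)` (supremum norm), with the uniform metric. -/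
abbrev UnitBall : Type _ := ↥(Metric.closedBall (0 : C(Strings Ω, ℝ)) 1)

/-- `S` carries its Borel σ-algebra. -/
instance UnitBall.instMeasurableSpace : MeasurableSpace (UnitBall Ω) := borel _

instance UnitBall.instBorelSpace : BorelSpace (UnitBall Ω) := ⟨rfl⟩

/-- `ℳ(S)`: the vector space of bounded, real-valued, Borel-measurable functions on `S`. -/
def BoundedMeasurable : Submodule ℝ (UnitBall Ω → ℝ) where
  carrier := {f | Measurable f ∧ ∃ C : ℝ, ∀ φ, |f φ| ≤ C}
  zero_mem' := ⟨measurable_const, 0, fun φ => by simp⟩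
  add_mem' := by
    rintro f g ⟨hf, C, hC⟩ ⟨hg, D, hD⟩
    exact ⟨hf.add hg, C + D, fun φ => (abs_add_le _ _).trans (add_le_add (hC φ) (hD φ))⟩
  smul_mem' := by
    rintro c f ⟨hf, C, hC⟩
    refine ⟨hf.const_smul c, |c| * C, fun φ => ?_⟩
    simpa [abs_mul] using mul_le_mul_of_nonneg_left (hC φ) (abs_nonneg c)

variable {Ω}

/-- `F : ℳ(S) → ℝ` is σ-normal: `F(fₙ) → F(f)` for every (uniformly) bounded sequence `fₙ` in
`ℳ(S)` that converges pointwise to `f ∈ ℳ(S)`. -/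
def SigmaNormal (F : BoundedMeasurable Ω → ℝ) : Prop :=
  ∀ (f : ℕ → BoundedMeasurable Ω) (g : BoundedMeasurable Ω),
    (∃ C : ℝ, ∀ n φ, |(f n).1 φ| ≤ C) →
    (∀ φ, Tendsto (fun n => (f n).1 φ) atTop (𝓝 (g.1 φ))) →
    Tendsto (fun n => F (f n)) atTop (𝓝 (F g))

/-- The restriction `ℓ_S ∈ ℳ(S)` to `S` of a continuous linear functional `ℓ` on `C(Σ)`. -/
def restrictS (ℓ : WeakDual ℝ C(Strings Ω, ℝ)) : BoundedMeasurable Ω :=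
  ⟨fun φ => ℓ φ.1, by
    have hc : Continuous (fun φ : UnitBall Ω => ℓ φ.1) :=
      (map_continuous ℓ).comp continuous_subtype_val
    refine ⟨hc.measurable, ‖WeakDual.toStrongDual ℓ‖, fun φ => ?_⟩
    have h1 : ‖φ.1‖ ≤ 1 := mem_closedBall_zero_iff.1 φ.2
    exact (WeakDual.toStrongDual ℓ).unit_le_opNorm φ.1 h1⟩

end Ball

section Invariant

/-- `𝒫(T)`: the shift-invariant Borel probability measures on `Σ`. -/
def InvMeasure (Ω : Type*) [MeasurableSpace Ω] : Type _ :=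
  {μ : ProbabilityMeasure (Strings Ω) //
    MeasurePreserving (shift Ω) (μ : Measure (Strings Ω)) (μ : Measure (Strings Ω))}

/-- The underlying measure on `Σ`. -/
def InvMeasure.toMeasure {Ω : Type*} [MeasurableSpace Ω] (μ : InvMeasure Ω) :
    Measure (Strings Ω) := (μ.1 : Measure (Strings Ω))

instance InvMeasure.instIsProbabilityMeasure {Ω : Type*} [MeasurableSpace Ω] (μ : InvMeasure Ω) :
    IsProbabilityMeasure μ.toMeasure :=
  inferInstanceAs (IsProbabilityMeasure (μ.1 : Measure (Strings Ω)))

/-- The convex combination `t μ + (1 - t) ν` in `𝒫(T)`, for `t ∈ [0, 1]`. -/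
def InvMeasure.mix {Ω : Type*} [MeasurableSpace Ω] (t : unitInterval) (μ ν : InvMeasure Ω) :
    InvMeasure Ω :=
  ⟨⟨ENNReal.ofReal t • μ.toMeasure + ENNReal.ofReal (1 - t) • ν.toMeasure, by
      constructor
      have h : ENNReal.ofReal (t : ℝ) + ENNReal.ofReal (1 - t) = 1 := by
        rw [← ENNReal.ofReal_add t.2.1 (sub_nonneg.2 t.2.2)]
        simp
      simpa using h⟩,
    ⟨μ.2.measurable, by
      change Measure.map (shift Ω) (_ • μ.toMeasure + _ • ν.toMeasure) = _
      rw [Measure.map_add _ _ μ.2.measurable, Measure.map_smul, Measure.map_smul]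
      exact congrArg₂ _ (congrArg _ μ.2.map_eq) (congrArg _ ν.2.map_eq)⟩⟩

/-- `f : 𝒫(T) → ℝ` is affine. -/
def IsAffine {Ω : Type*} [MeasurableSpace Ω] (f : InvMeasure Ω → ℝ) : Prop :=
  ∀ (t : unitInterval) (μ ν : InvMeasure Ω),
    f (InvMeasure.mix t μ ν) = t * f μ + (1 - t) * f ν

/-- `f : 𝒫(T) → ℝ` is convex. -/
def IsConvex {Ω : Type*} [MeasurableSpace Ω] (f : InvMeasure Ω → ℝ) : Prop :=
  ∀ (t : unitInterval) (μ ν : InvMeasure Ω),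
    f (InvMeasure.mix t μ ν) ≤ t * f μ + (1 - t) * f ν

/-- `f : 𝒫(T) → ℝ` is strictly convex. -/
def IsStrictlyConvex {Ω : Type*} [MeasurableSpace Ω] (f : InvMeasure Ω → ℝ) : Prop :=
  ∀ (t : unitInterval) (μ ν : InvMeasure Ω), 0 < t → t < 1 → μ ≠ ν →
    f (InvMeasure.mix t μ ν) < t * f μ + (1 - t) * f ν

/-- `𝒫_erg(T)`: the ergodic shift-invariant measures. -/
def ergodicMeasures (Ω : Type*) [MeasurableSpace Ω] : Set (InvMeasure Ω) :=
  {μ | Ergodic (shift Ω) μ.toMeasure}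

variable {Ω : Type*} [MetricSpace Ω] [CompactSpace Ω] [MeasurableSpace Ω] [BorelSpace Ω]

/-- The weak* topology on `𝒫(T)` (weak convergence of probability measures). -/
instance InvMeasure.instTopologicalSpace : TopologicalSpace (InvMeasure Ω) :=
  inferInstanceAs (TopologicalSpace {μ : ProbabilityMeasure (Strings Ω) //
    MeasurePreserving (shift Ω) (μ : Measure (Strings Ω)) (μ : Measure (Strings Ω))})

/-- `𝒫(T)` carries the Borel σ-algebra of the weak* topology. -/
instance InvMeasure.instMeasurableSpace : MeasurableSpace (InvMeasure Ω) := borel _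

instance InvMeasure.instBorelSpace : BorelSpace (InvMeasure Ω) := ⟨rfl⟩

/-- `μ ∈ 𝒫(T)` as the element `φ ↦ ∫ φ dμ` of the dual `C(Σ)*`, with its weak* topology. -/
def InvMeasure.toDual (μ : InvMeasure Ω) : WeakDual ℝ C(Strings Ω, ℝ) :=
  StrongDual.toWeakDual <|
    LinearMap.mkContinuous
      { toFun := fun φ : C(Strings Ω, ℝ) => ∫ σ, φ σ ∂μ.toMeasure
        map_add' := fun φ ψ => integral_add
          (φ.continuous.integrable_of_hasCompactSupport (HasCompactSupport.of_compactSpace _))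
          (ψ.continuous.integrable_of_hasCompactSupport (HasCompactSupport.of_compactSpace _))
        map_smul' := fun c φ => integral_const_mul c _ }
      1 (fun φ => by
        have h := norm_integral_le_of_norm_le_const (μ := μ.toMeasure)
          (Eventually.of_forall fun σ => φ.norm_coe_le_norm σ)
        simpa using h)

/-- `μ_S ∈ ℳ(S)`, i.e. `μ_S(φ) = ∫ φ dμ` for `φ ∈ S`. -/
def InvMeasure.onS (μ : InvMeasure Ω) : BoundedMeasurable Ω := restrictS μ.toDual

/-- `ξ` is a Choquet measure of `μ`: a Borel probability measure on `𝒫(T)` that is supported in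
`𝒫_erg(T)` and has barycenter `μ`. -/
def IsChoquetMeasure (μ : InvMeasure Ω) (ξ : Measure (InvMeasure Ω)) : Prop :=
  IsProbabilityMeasure ξ ∧ ξ (ergodicMeasures Ω)ᶜ = 0 ∧
    ∀ φ : C(Strings Ω, ℝ), ∫ σ, φ σ ∂μ.toMeasure = ∫ ν, (∫ σ, φ σ ∂ν.toMeasure) ∂ξ

/-- `ξ_μ`: the Choquet measure of `μ`. -/
def choquetMeasure (μ : InvMeasure Ω) : Measure (InvMeasure Ω) :=
  Classical.epsilon (IsChoquetMeasure μ)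

/-- `Δ^F(μ) = ∫_{𝒫_erg(T)} F(ν_S) ξ_μ(dν)`. -/
def Delta (F : BoundedMeasurable Ω → ℝ) (μ : InvMeasure Ω) : ℝ :=
  ∫ ν in ergodicMeasures Ω, F ν.onS ∂(choquetMeasure μ)

/-- The Γ-regularization of `f : 𝒫(T) → (-∞, ∞]`: the supremum of all affine weak*-continuous
functionals on `C(Σ)*` whose restriction to `𝒫(T)` is a minorant of `f`. -/
def gammaRegularization (f : InvMeasure Ω → EReal) (μ : InvMeasure Ω) : EReal :=
  sSup {x : EReal | ∃ m : WeakDual ℝ C(Strings Ω, ℝ) →ᴬ[ℝ] ℝ,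
    (∀ ν : InvMeasure Ω, (m ν.toDual : EReal) ≤ f ν) ∧ x = (m μ.toDual : EReal)}

end Invariant

end DeltaFunctional

end

/-!
Write `A_n f` for the Birkhoff average of `f ∈ C(Σ)` over `n + 1` steps of the shift, and
`empirical n σ` for the corresponding empirical measure of a string `σ`.

**Ergodic decomposition.** By the mean ergodic theorem in `L²(μ)`, the second moments of `A_n f`
converge, and for ergodic `ν` they converge to `(∫ f dν)²`. Conversely, if for `f` in a countable
dense set the variances of `A_n f` under `ν` come arbitrarily close to zero, then `ν` is ergodic
(`mem_ergodicMeasures_iff`); this exhibits the ergodic measures as a `G_δ`. Under an ergodic `ν` the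
empirical measures therefore converge in law to `ν`, and integrating over a Choquet measure `ξ` of
`μ` shows that `ξ` is the weak limit of the laws of the empirical measures under `μ`
(`IsChoquetMeasure.tendsto_integral_empirical`). This gives uniqueness. For existence, a limit law
along an ultrafilter exists by compactness, and the second moments show that it is carried by the
ergodic measures (`exists_isChoquetMeasure`).

**The functional.** Since `F` is defined on all bounded measurable functions, `F(ρ_S)` makes sense
for empirical measures `ρ`, and `Δ^F(μ)` is the limit of `∫ F((empirical n σ)_S) dμ(σ)`. Along
`n + 1 = 2 ^ k` these integrals decrease, by convexity of `F` and invariance of `μ`, so `Δ^F` is a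
decreasing limit of continuous affine functions: it is affine and upper semicontinuous. If `Δ^F` is
continuous, the convergence is uniform by Dini's theorem, and a uniform limit of functions
`μ ↦ ∫ f_k dμ` on `𝒫(T)` has the form `μ ↦ ∫ f dμ`, because a function with small integrals against
all invariant measures has a uniformly small Birkhoff average
(`exists_integral_eq_of_tendstoUniformly`).

**Comparison with `F(μ_S)`.** The map `μ ↦ F(μ_S)` is continuous and convex, so by Hahn–Banach it is
the supremum of its continuous affine minorants (`exists_affine_minorant`), and Jensen's inequality
gives `F(μ_S) ≤ Δ^F(μ)`, with equality at ergodic measures. Ergodic measures are dense: words sampled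
from `μ` are concatenated periodically, and the resulting periodic orbit measure approximates `μ`
(`exists_ergodic_near`). Hence `Δ^F(μ) = F(μ_S)` at every continuity point of `Δ^F`, and the
remaining assertions follow.
-/

set_option linter.unusedSectionVars false

noncomputable section

namespace DeltaFunctional

/-! ### The compact space of probability measures on strings -/

/-- All Borel probability measures on `Σ`, invariant or not, with the weak* topology. A separate
type rather than `ProbabilityMeasure (Strings Ω)`, so that it can carry the Borel σ-algebra of that
topology. -/
def StringMeasure (Ω : Type*) [MeasurableSpace Ω] : Type _ := ProbabilityMeasure (Strings Ω)

/-- The underlying measure on `Σ`. -/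
def StringMeasure.toMeasure {Ω : Type*} [MeasurableSpace Ω] (ρ : StringMeasure Ω) :
    Measure (Strings Ω) := ProbabilityMeasure.toMeasure ρ

instance {Ω : Type*} [MeasurableSpace Ω] (ρ : StringMeasure Ω) :
    IsProbabilityMeasure ρ.toMeasure :=
  Subtype.property (p := fun μ : Measure (Strings Ω) => IsProbabilityMeasure μ) ρ

/-- The inclusion of the invariant measures into all probability measures. -/
def InvMeasure.toStringMeasure {Ω : Type*} [MeasurableSpace Ω] (μ : InvMeasure Ω) :
    StringMeasure Ω := μ.1

theorem InvMeasure.toStringMeasure_injective {Ω : Type*} [MeasurableSpace Ω] :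
    Function.Injective (InvMeasure.toStringMeasure (Ω := Ω)) := Subtype.val_injective

variable {Ω : Type*} [MetricSpace Ω] [CompactSpace Ω] [MeasurableSpace Ω] [BorelSpace Ω]

theorem continuous_shift : Continuous (shift Ω) := by
  unfold shift; fun_prop

instance : TopologicalSpace (StringMeasure Ω) :=
  inferInstanceAs (TopologicalSpace (ProbabilityMeasure (Strings Ω)))

instance : CompactSpace (StringMeasure Ω) :=
  inferInstanceAs (CompactSpace (ProbabilityMeasure (Strings Ω)))

instance : TopologicalSpace.MetrizableSpace (StringMeasure Ω) :=
  inferInstanceAs (TopologicalSpace.MetrizableSpace (ProbabilityMeasure (Strings Ω)))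

instance : MeasurableSpace (StringMeasure Ω) := borel _

instance : BorelSpace (StringMeasure Ω) := ⟨rfl⟩

theorem InvMeasure.isEmbedding_toStringMeasure :
    IsEmbedding (InvMeasure.toStringMeasure (Ω := Ω)) := IsEmbedding.subtypeVal

instance : TopologicalSpace.MetrizableSpace (InvMeasure Ω) :=
  InvMeasure.isEmbedding_toStringMeasure.metrizableSpace

theorem integrable_continuousMap {Y : Type*} [TopologicalSpace Y] [CompactSpace Y]
    [MeasurableSpace Y] [OpensMeasurableSpace Y]
    {f : Y → ℝ} (hf : Continuous f) (μ : Measure Y) [IsFiniteMeasure μ] : Integrable f μ :=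
  hf.integrable_of_hasCompactSupport (HasCompactSupport.of_compactSpace _)

theorem StringMeasure.continuous_integral (f : C(Strings Ω, ℝ)) :
    Continuous fun ρ : StringMeasure Ω => ∫ σ, f σ ∂ρ.toMeasure :=
  ProbabilityMeasure.continuous_integral_continuousMap f

theorem StringMeasure.tendsto_iff {ι : Type*} {l : Filter ι} {u : ι → StringMeasure Ω}
    {ρ : StringMeasure Ω} : Tendsto u l (𝓝 ρ) ↔ ∀ f : C(Strings Ω, ℝ),
      Tendsto (fun i => ∫ σ, f σ ∂(u i).toMeasure) l (𝓝 (∫ σ, f σ ∂ρ.toMeasure)) := by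
  refine ⟨fun h f => ((continuous_integral f).tendsto ρ).comp h, fun h => ?_⟩
  refine ProbabilityMeasure.tendsto_iff_forall_integral_tendsto.2 fun f => ?_
  exact h f.toContinuousMap

theorem StringMeasure.ext_integral {ρ ρ' : StringMeasure Ω}
    (h : ∀ f : C(Strings Ω, ℝ), ∫ σ, f σ ∂ρ.toMeasure = ∫ σ, f σ ∂ρ'.toMeasure) : ρ = ρ' := by
  apply Subtype.ext
  change ρ.toMeasure = ρ'.toMeasure
  exact ext_of_forall_integral_eq_of_IsFiniteMeasure fun f => h f.toContinuousMap

theorem continuous_integral_measure {Y : Type*} [TopologicalSpace Y] [CompactSpace Y]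
    [MeasurableSpace Y] [OpensMeasurableSpace Y] (μ : Measure Y) [IsFiniteMeasure μ] :
    Continuous fun f : C(Y, ℝ) => ∫ y, f y ∂μ := by
  refine continuous_of_linear_of_bound (𝕜 := ℝ) (C := μ.real univ)
    (f := fun f : C(Y, ℝ) => ∫ y, f y ∂μ) ?_ ?_ ?_
  · exact fun f g => integral_add (integrable_continuousMap f.continuous μ)
      (integrable_continuousMap g.continuous μ)
  · exact fun c f => integral_const_mul c _
  · intro f
    have := norm_integral_le_of_norm_le_const (μ := μ)
      (Eventually.of_forall fun σ => f.norm_coe_le_norm σ)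
    linarith

theorem abs_integral_le_norm {Y : Type*} [TopologicalSpace Y] [CompactSpace Y]
    [MeasurableSpace Y] (f : C(Y, ℝ)) (μ : Measure Y) [IsProbabilityMeasure μ] :
    |∫ y, f y ∂μ| ≤ ‖f‖ := by
  have := norm_integral_le_of_norm_le_const (μ := μ)
    (Eventually.of_forall fun σ => f.norm_coe_le_norm σ)
  simpa using this

/-- A probability measure on `Σ` is determined by countably many integrals. -/
theorem StringMeasure.ext_denseSeq [Nonempty Ω] {ρ ρ' : StringMeasure Ω}
    (h : ∀ i, ∫ σ, TopologicalSpace.denseSeq C(Strings Ω, ℝ) i σ ∂ρ.toMeasure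
      = ∫ σ, TopologicalSpace.denseSeq C(Strings Ω, ℝ) i σ ∂ρ'.toMeasure) : ρ = ρ' := by
  refine StringMeasure.ext_integral fun f => ?_
  have := DenseRange.equalizer (TopologicalSpace.denseRange_denseSeq C(Strings Ω, ℝ))
    (continuous_integral_measure ρ.toMeasure) (continuous_integral_measure ρ'.toMeasure)
    (funext h)
  exact congrFun this f

theorem InvMeasure.continuous_integral (f : C(Strings Ω, ℝ)) :
    Continuous fun μ : InvMeasure Ω => ∫ σ, f σ ∂μ.toMeasure :=
  (StringMeasure.continuous_integral f).comp InvMeasure.isEmbedding_toStringMeasure.continuous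

theorem InvMeasure.tendsto_iff {ι : Type*} {l : Filter ι} {u : ι → InvMeasure Ω}
    {μ : InvMeasure Ω} : Tendsto u l (𝓝 μ) ↔ ∀ f : C(Strings Ω, ℝ),
      Tendsto (fun i => ∫ σ, f σ ∂(u i).toMeasure) l (𝓝 (∫ σ, f σ ∂μ.toMeasure)) := by
  rw [InvMeasure.isEmbedding_toStringMeasure.tendsto_nhds_iff, StringMeasure.tendsto_iff]
  rfl

theorem InvMeasure.ext_integral {μ ν : InvMeasure Ω}
    (h : ∀ f : C(Strings Ω, ℝ), ∫ σ, f σ ∂μ.toMeasure = ∫ σ, f σ ∂ν.toMeasure) : μ = ν :=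
  InvMeasure.toStringMeasure_injective (StringMeasure.ext_integral h)

/-- The function `f ∘ T`. -/
def compShift (f : C(Strings Ω, ℝ)) : C(Strings Ω, ℝ) := f.comp ⟨shift Ω, continuous_shift⟩

@[simp] theorem compShift_apply (f : C(Strings Ω, ℝ)) (σ : Strings Ω) :
    compShift f σ = f (shift Ω σ) := rfl

theorem InvMeasure.integral_comp_iterate (μ : InvMeasure Ω) (f : C(Strings Ω, ℝ)) (n : ℕ) :
    ∫ σ, f ((shift Ω)^[n] σ) ∂μ.toMeasure = ∫ σ, f σ ∂μ.toMeasure := by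
  have h : MeasurePreserving (shift Ω)^[n] μ.toMeasure μ.toMeasure := μ.2.iterate n
  rw [← integral_map h.measurable.aemeasurable f.continuous.aestronglyMeasurable, h.map_eq]

/-- Invariance is tested on a countable family of continuous functions. -/
theorem StringMeasure.mem_range_of_denseSeq [Nonempty Ω] {ρ : StringMeasure Ω}
    (h : ∀ i, ∫ σ, compShift (TopologicalSpace.denseSeq C(Strings Ω, ℝ) i) σ ∂ρ.toMeasure
      = ∫ σ, TopologicalSpace.denseSeq C(Strings Ω, ℝ) i σ ∂ρ.toMeasure) :
    ρ ∈ range (InvMeasure.toStringMeasure (Ω := Ω)) := by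
  have hm : Measurable (shift Ω) := continuous_shift.measurable
  have : IsProbabilityMeasure (ρ.toMeasure.map (shift Ω)) :=
    Measure.isProbabilityMeasure_map hm.aemeasurable
  let ρ' : StringMeasure Ω := ⟨ρ.toMeasure.map (shift Ω), this⟩
  have hρ : ρ' = ρ := by
    refine StringMeasure.ext_denseSeq fun i => ?_
    rw [← h i]
    exact integral_map hm.aemeasurable (ContinuousMap.continuous _).aestronglyMeasurable
  exact ⟨⟨ρ, hm, congrArg StringMeasure.toMeasure hρ⟩, rfl⟩

theorem InvMeasure.isClosed_range_toStringMeasure [Nonempty Ω] :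
    IsClosed (range (InvMeasure.toStringMeasure (Ω := Ω))) := by
  have : range (InvMeasure.toStringMeasure (Ω := Ω)) = ⋂ f : C(Strings Ω, ℝ),
      {ρ | ∫ σ, compShift f σ ∂ρ.toMeasure = ∫ σ, f σ ∂ρ.toMeasure} := by
    ext ρ
    simp only [mem_iInter, mem_ofPred_eq]
    refine ⟨?_, fun h => StringMeasure.mem_range_of_denseSeq fun i => h _⟩
    rintro ⟨μ, rfl⟩ f
    exact μ.integral_comp_iterate f 1
  rw [this]
  exact isClosed_iInter fun f => isClosed_eq (StringMeasure.continuous_integral _)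
    (StringMeasure.continuous_integral _)

theorem InvMeasure.isClosedEmbedding_toStringMeasure [Nonempty Ω] :
    IsClosedEmbedding (InvMeasure.toStringMeasure (Ω := Ω)) :=
  ⟨InvMeasure.isEmbedding_toStringMeasure, InvMeasure.isClosed_range_toStringMeasure⟩

instance [Nonempty Ω] : CompactSpace (InvMeasure Ω) :=
  InvMeasure.isClosedEmbedding_toStringMeasure.compactSpace

theorem integral_mix (t : unitInterval) (μ ν : InvMeasure Ω) (f : C(Strings Ω, ℝ)) :
    ∫ σ, f σ ∂(InvMeasure.mix t μ ν).toMeasure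
      = t * ∫ σ, f σ ∂μ.toMeasure + (1 - t) * ∫ σ, f σ ∂ν.toMeasure := by
  change ∫ σ, f σ ∂(ENNReal.ofReal t • μ.toMeasure + ENNReal.ofReal (1 - t) • ν.toMeasure) = _
  have h1 := integrable_continuousMap f.continuous μ.toMeasure
  have h2 := integrable_continuousMap f.continuous ν.toMeasure
  rw [integral_add_measure (h1.smul_measure (by simp)) (h2.smul_measure (by simp)),
    integral_smul_measure, integral_smul_measure, ENNReal.toReal_ofReal t.2.1,
    ENNReal.toReal_ofReal (sub_nonneg.2 t.2.2)]
  rfl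

/-! ### The functional on all probability measures -/

/-- `ρ_S ∈ ℳ(S)` for an arbitrary probability measure `ρ` on `Σ`. -/
def StringMeasure.onS (ρ : StringMeasure Ω) : BoundedMeasurable Ω :=
  ⟨fun φ => ∫ σ, φ.1 σ ∂ρ.toMeasure, by
    refine ⟨((continuous_integral_measure ρ.toMeasure).comp continuous_subtype_val).measurable,
      1, fun φ => (abs_integral_le_norm _ _).trans (mem_closedBall_zero_iff.1 φ.2)⟩⟩

/-- Weak* convergence of measures is bounded pointwise convergence on `S`, so σ-normality is
weak* continuity along measures. -/
theorem SigmaNormal.continuous_stringMeasure {F : BoundedMeasurable Ω → ℝ} (hF : SigmaNormal F) :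
    Continuous fun ρ : StringMeasure Ω => F ρ.onS := by
  rw [continuous_iff_seqContinuous]
  intro u ρ hu
  refine hF _ _ ⟨1, fun n φ => ?_⟩ fun φ => StringMeasure.tendsto_iff.1 hu φ.1
  exact (abs_integral_le_norm _ _).trans (mem_closedBall_zero_iff.1 φ.2)

theorem SigmaNormal.continuous_invMeasure {F : BoundedMeasurable Ω → ℝ} (hF : SigmaNormal F) :
    Continuous fun μ : InvMeasure Ω => F μ.onS :=
  hF.continuous_stringMeasure.comp InvMeasure.isEmbedding_toStringMeasure.continuous

theorem le_of_integral_eq_convex_combination {F : BoundedMeasurable Ω → ℝ}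
    (hF : ConvexOn ℝ univ F) {t : ℝ}
    (ht0 : 0 ≤ t) (ht1 : t ≤ 1) {ρ ρ₁ ρ₂ : StringMeasure Ω}
    (h : ∀ f : C(Strings Ω, ℝ), ∫ σ, f σ ∂ρ.toMeasure
      = t * ∫ σ, f σ ∂ρ₁.toMeasure + (1 - t) * ∫ σ, f σ ∂ρ₂.toMeasure) :
    F ρ.onS ≤ t * F ρ₁.onS + (1 - t) * F ρ₂.onS := by
  have : ρ.onS = t • ρ₁.onS + (1 - t) • ρ₂.onS := Subtype.ext (funext fun φ => h φ.1)
  rw [this]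
  exact hF.2 (mem_univ _) (mem_univ _) ht0 (sub_nonneg.2 ht1) (by ring)

theorem isConvex_onS {F : BoundedMeasurable Ω → ℝ} (hF : ConvexOn ℝ univ F) :
    IsConvex fun μ : InvMeasure Ω => F μ.onS := fun t μ ν =>
  le_of_integral_eq_convex_combination hF (ρ := (InvMeasure.mix t μ ν).toStringMeasure)
    (ρ₁ := μ.toStringMeasure) (ρ₂ := ν.toStringMeasure) t.2.1 t.2.2 (integral_mix t μ ν)

/-! ### Birkhoff averages and empirical measures -/

/-- The Birkhoff average `(n + 1)⁻¹ ∑_{i ≤ n} f ∘ Tⁱ`. The index is shifted by one so that every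
`n` gives a genuine average. -/
def average (n : ℕ) (f : C(Strings Ω, ℝ)) : C(Strings Ω, ℝ) :=
  ⟨birkhoffAverage ℝ (shift Ω) f (n + 1), by
    have h : ∀ i, Continuous ((shift Ω)^[i]) := fun i => continuous_shift.iterate i
    unfold birkhoffAverage birkhoffSum
    fun_prop⟩

theorem average_apply (n : ℕ) (f : C(Strings Ω, ℝ)) (σ : Strings Ω) :
    average n f σ = ((n : ℝ) + 1)⁻¹ * ∑ i ∈ Finset.range (n + 1), f ((shift Ω)^[i] σ) := by
  simp [average, birkhoffAverage, birkhoffSum]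

/-- The empirical measure `(n + 1)⁻¹ ∑_{i ≤ n} δ_{Tⁱσ}`. -/
def empirical (n : ℕ) (σ : Strings Ω) : StringMeasure Ω :=
  ⟨((n + 1 : ℕ) : ENNReal)⁻¹ • ∑ i ∈ Finset.range (n + 1), Measure.dirac ((shift Ω)^[i] σ), by
    constructor
    simp only [Measure.smul_apply, Measure.coe_finsetSum, Finset.sum_apply, measure_univ,
      Finset.sum_const, Finset.card_range, nsmul_eq_mul, mul_one, smul_eq_mul]
    exact ENNReal.inv_mul_cancel (by simp) (by simp)⟩

theorem integral_empirical (n : ℕ) (σ : Strings Ω) (f : C(Strings Ω, ℝ)) :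
    ∫ τ, f τ ∂(empirical n σ).toMeasure = average n f σ := by
  change ∫ τ, f τ ∂(((n + 1 : ℕ) : ENNReal)⁻¹ •
    ∑ i ∈ Finset.range (n + 1), Measure.dirac ((shift Ω)^[i] σ)) = _
  rw [integral_smul_measure, integral_finsetSum_measure
    (fun i _ => integrable_continuousMap f.continuous _), average_apply]
  simp only [integral_dirac, ENNReal.toReal_inv, ENNReal.toReal_natCast, smul_eq_mul]
  push_cast
  rfl

theorem continuous_empirical (n : ℕ) : Continuous (empirical (Ω := Ω) n) := by
  rw [continuous_iff_continuousAt]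
  intro σ
  refine StringMeasure.tendsto_iff.2 fun f => ?_
  simp only [integral_empirical]
  exact (average n f).continuous.tendsto σ

theorem InvMeasure.integral_average (μ : InvMeasure Ω) (n : ℕ) (f : C(Strings Ω, ℝ)) :
    ∫ σ, average n f σ ∂μ.toMeasure = ∫ σ, f σ ∂μ.toMeasure := by
  simp only [average_apply]
  have hi : ∀ i ∈ Finset.range (n + 1),
      Integrable (fun σ => f ((shift Ω)^[i] σ)) μ.toMeasure := fun i _ =>
    integrable_continuousMap (f.continuous.comp (continuous_shift.iterate i)) _
  rw [integral_const_mul, integral_finsetSum _ hi]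
  simp only [μ.integral_comp_iterate, Finset.sum_const, Finset.card_range, nsmul_eq_mul]
  push_cast
  field_simp

/-- Averages of a coboundary telescope. -/
theorem average_compShift_sub (n : ℕ) (f : C(Strings Ω, ℝ)) (σ : Strings Ω) :
    average n (compShift f) σ - average n f σ
      = ((n : ℝ) + 1)⁻¹ * (f ((shift Ω)^[n + 1] σ) - f σ) := by
  have h := Finset.sum_range_sub (fun i => f ((shift Ω)^[i] σ)) (n + 1)
  simp only [Function.iterate_zero, id_eq] at h
  rw [average_apply, average_apply, ← mul_sub, ← Finset.sum_sub_distrib, ← h]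
  simp only [compShift_apply, Function.iterate_succ_apply']

theorem abs_average_compShift_sub_le (n : ℕ) (f : C(Strings Ω, ℝ)) (σ : Strings Ω) :
    |average n (compShift f) σ - average n f σ| ≤ 2 * ‖f‖ * ((n : ℝ) + 1)⁻¹ := by
  rw [average_compShift_sub, abs_mul, abs_of_pos (by positivity : (0 : ℝ) < ((n : ℝ) + 1)⁻¹), mul_comm]
  have h1 := f.norm_coe_le_norm ((shift Ω)^[n + 1] σ)
  have h2 := f.norm_coe_le_norm σ
  have h3 := norm_sub_le (f ((shift Ω)^[n + 1] σ)) (f σ)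
  rw [Real.norm_eq_abs] at h3
  gcongr
  linarith

/-! ### The mean ergodic theorem -/

/-- The Koopman operator of the shift on `L²(μ)`. -/
def koopman (μ : InvMeasure Ω) : Lp ℝ 2 μ.toMeasure →L[ℝ] Lp ℝ 2 μ.toMeasure :=
  (Lp.compMeasurePreservingₗᵢ ℝ (shift Ω) μ.2).toContinuousLinearMap

/-- A continuous function as an element of `L²(μ)`. -/
def toL2 (μ : InvMeasure Ω) : C(Strings Ω, ℝ) →L[ℝ] Lp ℝ 2 μ.toMeasure :=
  ContinuousMap.toLp 2 μ.toMeasure ℝ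

theorem inner_toL2 (μ : InvMeasure Ω) (f g : C(Strings Ω, ℝ)) :
    inner ℝ (toL2 μ f) (toL2 μ g) = ∫ σ, f σ * g σ ∂μ.toMeasure := by
  rw [toL2, ContinuousMap.inner_toLp]
  simp [mul_comm]

theorem koopman_toL2 (μ : InvMeasure Ω) (f : C(Strings Ω, ℝ)) :
    koopman μ (toL2 μ f) = toL2 μ (compShift f) := by
  apply Lp.ext
  have h1 : (koopman μ (toL2 μ f) : Strings Ω → ℝ) =ᵐ[μ.toMeasure] toL2 μ f ∘ shift Ω :=
    Lp.coeFn_compMeasurePreserving _ μ.2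
  have h2 : (toL2 μ f : Strings Ω → ℝ) =ᵐ[μ.toMeasure] f := ContinuousMap.coeFn_toLp _ _
  have h3 : (toL2 μ (compShift f) : Strings Ω → ℝ) =ᵐ[μ.toMeasure] compShift f :=
    ContinuousMap.coeFn_toLp _ _
  refine h1.trans (EventuallyEq.trans ?_ h3.symm)
  exact μ.2.quasiMeasurePreserving.ae_eq_comp h2

theorem compShift_iterate_apply (f : C(Strings Ω, ℝ)) (i : ℕ) (σ : Strings Ω) :
    compShift^[i] f σ = f ((shift Ω)^[i] σ) := by
  induction i generalizing σ with
  | zero => rfl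
  | succ i ih => rw [Function.iterate_succ_apply', compShift_apply, ih, Function.iterate_succ_apply]

theorem birkhoffAverage_koopman (μ : InvMeasure Ω) (f : C(Strings Ω, ℝ)) (n : ℕ) :
    birkhoffAverage ℝ (koopman μ) id (n + 1) (toL2 μ f) = toL2 μ (average n f) := by
  have h : ∀ i, (koopman μ)^[i] (toL2 μ f) = toL2 μ (compShift^[i] f) := by
    intro i
    induction i with
    | zero => rfl
    | succ i ih => rw [Function.iterate_succ_apply', ih, koopman_toL2, Function.iterate_succ_apply']
  have h2 : average n f = ((n + 1 : ℕ) : ℝ)⁻¹ • ∑ i ∈ Finset.range (n + 1), compShift^[i] f := by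
    ext σ
    simp [average_apply, compShift_iterate_apply]
  rw [h2, map_smul, map_sum, birkhoffAverage, birkhoffSum]
  simp only [id, h]

theorem exists_tendsto_birkhoffAverage {E : Type*} [NormedAddCommGroup E] [InnerProductSpace ℝ E]
    [CompleteSpace E] (U : E →L[ℝ] E) (hU : ‖U‖ ≤ 1) (x : E) :
    ∃ p, U p = p ∧ Tendsto (fun n => birkhoffAverage ℝ U id n x) atTop (𝓝 p) :=
  ⟨_, ((U.eqLocus (1 : E →L[ℝ] E)).orthogonalProjectionOnto x).2,
    U.tendsto_birkhoffAverage_orthogonalProjection hU x⟩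

/-- The mean ergodic theorem: Birkhoff averages converge in `L²(μ)` to a fixed vector. -/
theorem exists_tendsto_toL2_average (μ : InvMeasure Ω) (f : C(Strings Ω, ℝ)) :
    ∃ p : Lp ℝ 2 μ.toMeasure, koopman μ p = p ∧
      Tendsto (fun n => toL2 μ (average n f)) atTop (𝓝 p) := by
  obtain ⟨p, hp, h⟩ := exists_tendsto_birkhoffAverage (koopman μ)
    (LinearIsometry.norm_toContinuousLinearMap_le _) (toL2 μ f)
  refine ⟨p, hp, ?_⟩
  simpa only [birkhoffAverage_koopman, Function.comp_def] using h.comp (tendsto_add_atTop_nat 1)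

theorem norm_sq_toL2 (μ : InvMeasure Ω) (f : C(Strings Ω, ℝ)) :
    ‖toL2 μ f‖ ^ 2 = ∫ σ, f σ ^ 2 ∂μ.toMeasure := by
  rw [← real_inner_self_eq_norm_sq, inner_toL2]
  simp only [pow_two]

theorem exists_tendsto_integral_average_sq (μ : InvMeasure Ω) (f : C(Strings Ω, ℝ)) :
    ∃ c, Tendsto (fun n => ∫ σ, average n f σ ^ 2 ∂μ.toMeasure) atTop (𝓝 c) := by
  obtain ⟨p, -, hp⟩ := exists_tendsto_toL2_average μ f
  refine ⟨‖p‖ ^ 2, ?_⟩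
  simpa only [norm_sq_toL2] using hp.norm.pow 2

theorem tendsto_integral_average_sq_of_ergodic {ν : InvMeasure Ω} (hν : ν ∈ ergodicMeasures Ω)
    (f : C(Strings Ω, ℝ)) :
    Tendsto (fun n => ∫ σ, average n f σ ^ 2 ∂ν.toMeasure) atTop
      (𝓝 ((∫ σ, f σ ∂ν.toMeasure) ^ 2)) := by
  obtain ⟨p, hpf, hp⟩ := exists_tendsto_toL2_average ν f
  -- a fixed vector of the Koopman operator is constant by ergodicity
  obtain ⟨c, hc⟩ : ∃ c : ℝ, p = toL2 ν (ContinuousMap.const _ c) := by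
    have h1 : (koopman ν p : Strings Ω → ℝ) =ᵐ[ν.toMeasure] p ∘ shift Ω :=
      Lp.coeFn_compMeasurePreserving _ ν.2
    rw [hpf] at h1
    obtain ⟨c, hc⟩ := Ergodic.ae_eq_const_of_ae_eq_comp_ae hν
      (Lp.aestronglyMeasurable p) h1.symm
    refine ⟨c, Lp.ext (hc.trans ?_)⟩
    exact (ContinuousMap.coeFn_toLp (𝕜 := ℝ) (p := 2) ν.toMeasure
      (ContinuousMap.const (Strings Ω) c)).symm
  have h2 : Tendsto (fun _ : ℕ => ∫ σ, f σ ∂ν.toMeasure) atTop (𝓝 c) := by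
    have h := ((tendsto_const_nhds (x := toL2 ν (ContinuousMap.const _ 1))).inner hp (𝕜 := ℝ))
    rw [hc] at h
    simpa [inner_toL2, InvMeasure.integral_average] using h
  rw [tendsto_nhds_unique h2 tendsto_const_nhds] at hc
  have h3 := hp.norm.pow 2
  rw [hc] at h3
  simpa [norm_sq_toL2] using h3

/-! ### Ergodicity tested on Birkhoff averages -/

theorem sq_integral_le {Y : Type*} [MeasurableSpace Y] (μ : Measure Y) [IsProbabilityMeasure μ]
    {g : Y → ℝ} (hg : MemLp g 2 μ) : (∫ y, g y ∂μ) ^ 2 ≤ ∫ y, g y ^ 2 ∂μ := by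
  have h := ProbabilityTheory.variance_nonneg g μ
  rw [ProbabilityTheory.variance_eq_sub hg] at h
  simpa using h

theorem memLp_continuousMap {Y : Type*} [TopologicalSpace Y] [CompactSpace Y]
    [MeasurableSpace Y] [OpensMeasurableSpace Y] (f : C(Y, ℝ)) (μ : Measure Y)
    [IsFiniteMeasure μ] : MemLp f 2 μ :=
  (MemLp.of_bound (integrable_continuousMap f.continuous μ).aestronglyMeasurable ‖f‖
    (Eventually.of_forall f.norm_coe_le_norm))

theorem integral_sub_const_sq {Y : Type*} [TopologicalSpace Y] [CompactSpace Y]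
    [MeasurableSpace Y] [OpensMeasurableSpace Y] (f : C(Y, ℝ)) (μ : Measure Y)
    [IsProbabilityMeasure μ] {c : ℝ} (hc : ∫ y, f y ∂μ = c) :
    ∫ y, (f y - c) ^ 2 ∂μ = ∫ y, f y ^ 2 ∂μ - c ^ 2 := by
  have h1 : Integrable (fun y => f y ^ 2) μ := integrable_continuousMap (f.continuous.pow 2) μ
  have h2 : Integrable (fun y => 2 * c * f y) μ :=
    (integrable_continuousMap f.continuous μ).const_mul _
  have : ∀ y, (f y - c) ^ 2 = f y ^ 2 - 2 * c * f y + c ^ 2 := fun y => by ring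
  simp only [this]
  have h3 : Integrable (fun y => f y ^ 2 - 2 * c * f y) μ := h1.sub h2
  rw [integral_add h3 (integrable_const _), integral_sub h1 h2, integral_const_mul, hc]
  simp
  ring

/-- Invariant events are uncorrelated with `f` when the variances of the Birkhoff averages of `f`
come arbitrarily close to zero. -/
theorem setIntegral_eq_of_average {ν : InvMeasure Ω} {f : C(Strings Ω, ℝ)}
    (h : ∀ ε > 0, ∃ n, ∫ σ, average n f σ ^ 2 ∂ν.toMeasure - (∫ σ, f σ ∂ν.toMeasure) ^ 2 < ε)
    {s : Set (Strings Ω)} (hs : MeasurableSet s) (hinv : shift Ω ⁻¹' s = s) :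
    ∫ σ in s, f σ ∂ν.toMeasure = (∫ σ, f σ ∂ν.toMeasure) * ν.toMeasure.real s := by
  set c := ∫ σ, f σ ∂ν.toMeasure with hc
  have hiter : ∀ i, (shift Ω)^[i] ⁻¹' s = s := fun i => by
    rw [preimage_iterate_eq]
    exact Function.iterate_fixed hinv i
  have hmean : ∀ n, ∫ σ in s, average n f σ ∂ν.toMeasure = ∫ σ in s, f σ ∂ν.toMeasure := by
    intro n
    simp only [average_apply]
    have hi : ∀ i ∈ Finset.range (n + 1),
        Integrable (fun σ => f ((shift Ω)^[i] σ)) (ν.toMeasure.restrict s) := fun i _ =>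
      integrable_continuousMap (f.continuous.comp (continuous_shift.iterate i)) _
    rw [integral_const_mul, integral_finsetSum _ hi]
    have : ∀ i, ∫ σ in s, f ((shift Ω)^[i] σ) ∂ν.toMeasure = ∫ σ in s, f σ ∂ν.toMeasure := by
      intro i
      have hT : MeasurePreserving (shift Ω)^[i] (ν.toMeasure.restrict s)
          (ν.toMeasure.restrict s) := by
        have := MeasurePreserving.restrict_preimage (ν.2.iterate i) hs
        rwa [hiter i] at this
      rw [← integral_map hT.measurable.aemeasurable f.continuous.aestronglyMeasurable, hT.map_eq]
    simp only [this, Finset.sum_const, Finset.card_range, nsmul_eq_mul]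
    push_cast
    field_simp
  have key : ∀ ε > 0, (∫ σ in s, f σ ∂ν.toMeasure - c * ν.toMeasure.real s) ^ 2 ≤ ε := by
    intro ε hε
    obtain ⟨n, hn⟩ := h ε hε
    let g : C(Strings Ω, ℝ) := average n f - ContinuousMap.const _ c
    have e1 : ∫ σ in s, f σ ∂ν.toMeasure - c * ν.toMeasure.real s
        = ∫ σ, s.indicator g σ ∂ν.toMeasure := by
      rw [integral_indicator hs, ← hmean n]
      change _ = ∫ σ in s, (average n f σ - c) ∂ν.toMeasure
      rw [integral_sub (integrable_continuousMap (average n f).continuous _) (integrable_const _)]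
      simp [mul_comm]
    rw [e1]
    refine (sq_integral_le _ ((memLp_continuousMap g ν.toMeasure).indicator hs)).trans ?_
    have e2 : ∫ σ, s.indicator g σ ^ 2 ∂ν.toMeasure ≤ ∫ σ, (average n f σ - c) ^ 2 ∂ν.toMeasure := by
      refine integral_mono ?_ (integrable_continuousMap (g.continuous.pow 2) _) fun σ => ?_
      · exact ((memLp_continuousMap g ν.toMeasure).indicator hs).integrable_sq
      · by_cases hσ : σ ∈ s
        · simp [hσ, g]
        · simp [hσ, sq_nonneg]
    rw [integral_sub_const_sq _ _ (ν.integral_average n f)] at e2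
    linarith
  have : (∫ σ in s, f σ ∂ν.toMeasure - c * ν.toMeasure.real s) ^ 2 ≤ 0 :=
    le_of_forall_pos_le_add fun ε hε => by simpa using key ε hε
  have := pow_eq_zero_iff (two_ne_zero) |>.1 (le_antisymm this (sq_nonneg _))
  linarith

/-- Ergodicity is a condition on the variances of Birkhoff averages of countably many functions. -/
theorem mem_ergodicMeasures_iff [Nonempty Ω] {ν : InvMeasure Ω} :
    ν ∈ ergodicMeasures Ω ↔ ∀ i, ∀ ε > 0, ∃ n,
      ∫ σ, average n (TopologicalSpace.denseSeq C(Strings Ω, ℝ) i) σ ^ 2 ∂ν.toMeasure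
        - (∫ σ, TopologicalSpace.denseSeq C(Strings Ω, ℝ) i σ ∂ν.toMeasure) ^ 2 < ε := by
  constructor
  · intro hν i ε hε
    have h := (tendsto_integral_average_sq_of_ergodic hν
      (TopologicalSpace.denseSeq C(Strings Ω, ℝ) i)).sub_const
      ((∫ σ, TopologicalSpace.denseSeq C(Strings Ω, ℝ) i σ ∂ν.toMeasure) ^ 2)
    rw [sub_self] at h
    exact (h.eventually_lt_const hε).exists
  · intro h
    refine ⟨ν.2, ⟨fun {s} hs hinv => ?_⟩⟩
    have h1 : ∀ f : C(Strings Ω, ℝ), ∫ σ in s, f σ ∂ν.toMeasure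
        = (∫ σ, f σ ∂ν.toMeasure) * ν.toMeasure.real s := fun f =>
      congrFun (DenseRange.equalizer (TopologicalSpace.denseRange_denseSeq C(Strings Ω, ℝ))
        (continuous_integral_measure (ν.toMeasure.restrict s))
        ((continuous_integral_measure ν.toMeasure).mul continuous_const)
        (funext fun i => setIntegral_eq_of_average (h i) hs hinv)) f
    have h2 : ν.toMeasure.restrict s = ν.toMeasure s • ν.toMeasure := by
      have : IsFiniteMeasure (ν.toMeasure s • ν.toMeasure) :=
        Measure.smul_finite _ (measure_ne_top _ _)
      refine ext_of_forall_integral_eq_of_IsFiniteMeasure fun f => ?_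
      rw [integral_smul_measure, smul_eq_mul, mul_comm]
      exact h1 f.toContinuousMap
    -- an event independent of itself has measure zero or one
    have h3 : ν.toMeasure s = ν.toMeasure s * ν.toMeasure s := by
      have := congrArg (fun m => m s) h2
      simpa using this
    rw [eventuallyConst_set']
    by_cases h0 : ν.toMeasure s = 0
    · exact Or.inl (ae_eq_empty.2 h0)
    · refine Or.inr ((ae_eq_univ_iff_measure_eq hs.nullMeasurableSet).2 ?_)
      rw [measure_univ]
      exact (ENNReal.mul_eq_left h0 (measure_ne_top _ _)).1 h3.symm

theorem isGδ_ergodicMeasures [Nonempty Ω] : IsGδ (ergodicMeasures Ω) := by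
  have : ergodicMeasures Ω = ⋂ i : ℕ, ⋂ k : ℕ, ⋃ n : ℕ, {ν : InvMeasure Ω |
      ∫ σ, average n (TopologicalSpace.denseSeq C(Strings Ω, ℝ) i) σ ^ 2 ∂ν.toMeasure
        - (∫ σ, TopologicalSpace.denseSeq C(Strings Ω, ℝ) i σ ∂ν.toMeasure) ^ 2
          < 1 / ((k : ℝ) + 1)} := by
    ext ν
    rw [mem_ergodicMeasures_iff]
    simp only [mem_iInter, mem_iUnion, mem_ofPred_eq]
    refine forall_congr' fun i => ⟨fun h k => h _ (by positivity), fun h ε hε => ?_⟩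
    obtain ⟨k, hk⟩ := exists_nat_one_div_lt hε
    exact (h k).imp fun n hn => hn.trans hk
  rw [this]
  refine IsGδ.iInter fun i => IsGδ.iInter fun k => (isOpen_iUnion fun n => ?_).isGδ
  refine isOpen_lt (Continuous.sub ?_ ((InvMeasure.continuous_integral _).pow 2)) continuous_const
  exact InvMeasure.continuous_integral 
    (average n (TopologicalSpace.denseSeq C(Strings Ω, ℝ) i) ^ 2)

/-! ### Limits of the laws of empirical measures -/

/-- Along an ultrafilter the laws of the empirical measures converge weakly, because the
probability measures on the compact space `StringMeasure Ω` are themselves compact. -/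
theorem exists_limit_law (μ : Measure (Strings Ω)) [IsProbabilityMeasure μ] (U : Ultrafilter ℕ) :
    ∃ ξ : Measure (StringMeasure Ω), IsProbabilityMeasure ξ ∧ ∀ g : C(StringMeasure Ω, ℝ),
      Tendsto (fun n => ∫ σ, g (empirical n σ) ∂μ) U (𝓝 (∫ ρ, g ρ ∂ξ)) := by
  have hm : ∀ n, AEMeasurable (empirical (Ω := Ω) n) μ :=
    fun n => (continuous_empirical n).measurable.aemeasurable
  let law : ℕ → ProbabilityMeasure (StringMeasure Ω) :=
    fun n => ⟨μ.map (empirical n), Measure.isProbabilityMeasure_map (hm n)⟩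
  obtain ⟨ξ, -, hξ⟩ := isCompact_univ.ultrafilter_le_nhds (U.map law) (by simp)
  refine ⟨ξ, inferInstance, fun g => ?_⟩
  have h : Tendsto law U (𝓝 ξ) := hξ
  have h2 := ((ProbabilityMeasure.continuous_integral_continuousMap g).tendsto ξ).comp h
  refine h2.congr fun n => ?_
  exact integral_map (hm n) g.continuous.aestronglyMeasurable

/-- The evaluation `ρ ↦ ∫ f dρ` as a continuous function. -/
def evaluation (f : C(Strings Ω, ℝ)) : C(StringMeasure Ω, ℝ) :=
  ⟨fun ρ => ∫ σ, f σ ∂ρ.toMeasure, StringMeasure.continuous_integral f⟩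

theorem evaluation_empirical (f : C(Strings Ω, ℝ)) (n : ℕ) (σ : Strings Ω) :
    evaluation f (empirical n σ) = average n f σ := integral_empirical n σ f

/-- Under an ergodic measure the empirical measures converge in law to that measure: the limiting
variance of every continuous test function vanishes. -/
theorem tendsto_integral_empirical_of_ergodic [Nonempty Ω] {ν : InvMeasure Ω}
    (hν : ν ∈ ergodicMeasures Ω) (g : C(StringMeasure Ω, ℝ)) :
    Tendsto (fun n => ∫ σ, g (empirical n σ) ∂ν.toMeasure) atTop (𝓝 (g ν.toStringMeasure)) := by
  rw [tendsto_iff_ultrafilter]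
  intro U hU
  obtain ⟨ξ, hξ, hlim⟩ := exists_limit_law ν.toMeasure U
  have hconst : ∀ f : C(Strings Ω, ℝ),
      ∀ᵐ ρ ∂ξ, ∫ σ, f σ ∂ρ.toMeasure = ∫ σ, f σ ∂ν.toMeasure := by
    intro f
    let v : C(StringMeasure Ω, ℝ) :=
      (evaluation f - ContinuousMap.const _ (∫ σ, f σ ∂ν.toMeasure)) ^ 2
    have h1 : ∫ ρ, v ρ ∂ξ = 0 := by
      refine tendsto_nhds_unique (hlim v) ?_
      have h2 := (tendsto_integral_average_sq_of_ergodic hν f).sub_const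
        ((∫ σ, f σ ∂ν.toMeasure) ^ 2)
      rw [sub_self] at h2
      refine (h2.congr fun n => ?_).mono_left hU
      rw [← integral_sub_const_sq _ _ (ν.integral_average n f)]
      simp [v, evaluation_empirical]
    have h3 := (integral_eq_zero_iff_of_nonneg (fun ρ => sq_nonneg _)
      (integrable_continuousMap v.continuous ξ)).1 h1
    filter_upwards [h3] with ρ hρ
    exact sub_eq_zero.1 (pow_eq_zero_iff two_ne_zero |>.1 hρ)
  have hae : ∀ᵐ ρ ∂ξ, ρ = ν.toStringMeasure := by
    filter_upwards [ae_all_iff.2 fun i => hconst (TopologicalSpace.denseSeq C(Strings Ω, ℝ) i)]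
      with ρ hρ
    exact StringMeasure.ext_denseSeq hρ
  have : ∫ ρ, g ρ ∂ξ = g ν.toStringMeasure := by
    rw [integral_congr_ae (g := fun _ => g ν.toStringMeasure) (hae.mono fun ρ hρ => by simp [hρ])]
    simp
  exact this ▸ hlim g

/-! ### Ergodic decomposition -/

theorem measurableSet_ergodicMeasures [Nonempty Ω] : MeasurableSet (ergodicMeasures Ω) :=
  isGδ_ergodicMeasures.measurableSet

/-- A Choquet measure of `μ` is the limit of the laws of the empirical measures under `μ`, so it is
determined by `μ`. -/
theorem IsChoquetMeasure.tendsto_integral_empirical [Nonempty Ω] {μ : InvMeasure Ω}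
    {ξ : Measure (InvMeasure Ω)} (h : IsChoquetMeasure μ ξ) (g : C(StringMeasure Ω, ℝ)) :
    Tendsto (fun n => ∫ σ, g (empirical n σ) ∂μ.toMeasure) atTop
      (𝓝 (∫ ν, g ν.toStringMeasure ∂ξ)) := by
  obtain ⟨hprob, herg, hbar⟩ := h
  let G : ℕ → C(Strings Ω, ℝ) := fun n => g.comp ⟨empirical n, continuous_empirical n⟩
  have h1 : ∀ n, ∫ σ, g (empirical n σ) ∂μ.toMeasure
      = ∫ ν, (∫ σ, g (empirical n σ) ∂ν.toMeasure) ∂ξ := fun n => hbar (G n)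
  simp only [h1]
  refine tendsto_integral_of_dominated_convergence (fun _ => ‖g‖) (fun n => ?_)
    (integrable_const _) (fun n => Eventually.of_forall fun ν => ?_) ?_
  · exact (InvMeasure.continuous_integral (G n)).aestronglyMeasurable
  · have := norm_integral_le_of_norm_le_const (μ := ν.toMeasure)
      (Eventually.of_forall fun σ => g.norm_coe_le_norm (empirical n σ))
    simpa using this
  · filter_upwards [measure_eq_zero_iff_ae_notMem.1 herg] with ν hν
    exact tendsto_integral_empirical_of_ergodic (not_notMem.1 hν) g

theorem IsChoquetMeasure.unique [Nonempty Ω] {μ : InvMeasure Ω} {ξ ξ' : Measure (InvMeasure Ω)}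
    (h : IsChoquetMeasure μ ξ) (h' : IsChoquetMeasure μ ξ') : ξ = ξ' := by
  have := h.1
  have := h'.1
  have he := InvMeasure.isClosedEmbedding_toStringMeasure (Ω := Ω)
  have hm : Measurable (InvMeasure.toStringMeasure (Ω := Ω)) := he.continuous.measurable
  have : IsProbabilityMeasure (ξ.map InvMeasure.toStringMeasure) :=
    Measure.isProbabilityMeasure_map hm.aemeasurable
  have : IsProbabilityMeasure (ξ'.map InvMeasure.toStringMeasure) :=
    Measure.isProbabilityMeasure_map hm.aemeasurable
  have hmap : ξ.map InvMeasure.toStringMeasure = ξ'.map InvMeasure.toStringMeasure := by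
    refine ext_of_forall_integral_eq_of_IsFiniteMeasure fun g => ?_
    rw [integral_map hm.aemeasurable g.continuous.aestronglyMeasurable,
      integral_map hm.aemeasurable g.continuous.aestronglyMeasurable]
    exact tendsto_nhds_unique (h.tendsto_integral_empirical g.toContinuousMap)
      (h'.tendsto_integral_empirical g.toContinuousMap)
  rw [← he.measurableEmbedding.comap_map ξ, hmap, he.measurableEmbedding.comap_map]

/-- A limit law of the empirical measures lives on invariant measures. -/
theorem ae_mem_range_of_limit_law [Nonempty Ω] {μ : InvMeasure Ω} {U : Ultrafilter ℕ}
    (hU : (U : Filter ℕ) ≤ atTop) {ξ : Measure (StringMeasure Ω)} [IsProbabilityMeasure ξ]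
    (hlim : ∀ g : C(StringMeasure Ω, ℝ),
      Tendsto (fun n => ∫ σ, g (empirical n σ) ∂μ.toMeasure) U (𝓝 (∫ ρ, g ρ ∂ξ))) :
    ∀ᵐ ρ ∂ξ, ρ ∈ range (InvMeasure.toStringMeasure (Ω := Ω)) := by
  have hinv : ∀ f : C(Strings Ω, ℝ),
      ∀ᵐ ρ ∂ξ, ∫ σ, compShift f σ ∂ρ.toMeasure = ∫ σ, f σ ∂ρ.toMeasure := by
    intro f
    let v : C(StringMeasure Ω, ℝ) := |evaluation (compShift f) - evaluation f|
    have h1 : ∫ ρ, v ρ ∂ξ = 0 := by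
      refine tendsto_nhds_unique (hlim v) (Tendsto.mono_left ?_ hU)
      have h2 : Tendsto (fun n : ℕ => 2 * ‖f‖ * ((n : ℝ) + 1)⁻¹) atTop (𝓝 0) := by
        have := (tendsto_one_div_add_atTop_nhds_zero_nat (𝕜 := ℝ)).const_mul (2 * ‖f‖)
        simpa using this
      refine squeeze_zero (fun n => integral_nonneg fun σ => abs_nonneg _) (fun n => ?_) h2
      have h3 : ∀ σ, ‖v (empirical n σ)‖ ≤ 2 * ‖f‖ * ((n : ℝ) + 1)⁻¹ := fun σ => by
        simpa [v, evaluation_empirical] using abs_average_compShift_sub_le n f σ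
      have h4 := norm_integral_le_of_norm_le_const (μ := μ.toMeasure) (Eventually.of_forall h3)
      simp only [probReal_univ, mul_one] at h4
      exact (le_abs_self _).trans h4
    have h3 := (integral_eq_zero_iff_of_nonneg (fun ρ => abs_nonneg _)
      (integrable_continuousMap v.continuous ξ)).1 h1
    filter_upwards [h3] with ρ hρ
    exact sub_eq_zero.1 (abs_eq_zero.1 hρ)
  filter_upwards [ae_all_iff.2 fun i => hinv (TopologicalSpace.denseSeq C(Strings Ω, ℝ) i)]
    with ρ hρ
  exact StringMeasure.mem_range_of_denseSeq hρ

/-- A limit law of the empirical measures lives on measures under which the variances of Birkhoff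
averages come arbitrarily close to zero: the mean of the variance of the `m`-th average is the
difference of the `m`-th and the limiting second moment under `μ`. -/
theorem ae_average_variance_small_of_limit_law [Nonempty Ω] {μ : InvMeasure Ω} {U : Ultrafilter ℕ}
    (hU : (U : Filter ℕ) ≤ atTop) {ξ : Measure (StringMeasure Ω)} [IsProbabilityMeasure ξ]
    (hlim : ∀ g : C(StringMeasure Ω, ℝ),
      Tendsto (fun n => ∫ σ, g (empirical n σ) ∂μ.toMeasure) U (𝓝 (∫ ρ, g ρ ∂ξ)))
    (f : C(Strings Ω, ℝ)) :
    ∀ᵐ ρ ∂ξ, ∀ ε > 0, ∃ m,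
      ∫ σ, average m f σ ^ 2 ∂ρ.toMeasure - (∫ σ, f σ ∂ρ.toMeasure) ^ 2 < ε := by
  have hinv := ae_mem_range_of_limit_law hU hlim
  obtain ⟨c, hc⟩ := exists_tendsto_integral_average_sq μ f
  let v : ℕ → C(StringMeasure Ω, ℝ) := fun m => evaluation (average m f ^ 2) - evaluation f ^ 2
  have hv : ∀ m, ∫ ρ, v m ρ ∂ξ = ∫ σ, average m f σ ^ 2 ∂μ.toMeasure - c := by
    intro m
    refine tendsto_nhds_unique (hlim (v m)) ?_
    have h1 := (hc.const_sub (∫ σ, average m f σ ^ 2 ∂μ.toMeasure)).mono_left hU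
    refine h1.congr fun n => ?_
    have h2 : ∀ σ, v m (empirical n σ) = average n (average m f ^ 2) σ - average n f σ ^ 2 := by
      intro σ
      simp [v, evaluation_empirical]
    simp only [h2]
    have h3 : Integrable (fun σ => average n f σ ^ 2) μ.toMeasure :=
      integrable_continuousMap ((average n f).continuous.pow 2) _
    rw [integral_sub (integrable_continuousMap (average n (average m f ^ 2)).continuous _) h3,
      μ.integral_average]
    rfl
  have hv0 : Tendsto (fun m => ∫ ρ, v m ρ ∂ξ) atTop (𝓝 0) := by
    simpa [hv] using hc.sub_const c
  have hnonneg : ∀ m, ∀ᵐ ρ ∂ξ, 0 ≤ v m ρ := by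
    intro m
    filter_upwards [hinv] with ρ hρ
    obtain ⟨ν, rfl⟩ := hρ
    have := integral_sub_const_sq _ _ (ν.integral_average m f)
    change 0 ≤ ∫ σ, average m f σ ^ 2 ∂ν.toMeasure - (∫ σ, f σ ∂ν.toMeasure) ^ 2
    rw [← this]
    exact integral_nonneg fun σ => sq_nonneg _
  have hε : ∀ k : ℕ, ∀ᵐ ρ ∂ξ, ∃ m, v m ρ < 1 / ((k : ℝ) + 1) := by
    intro k
    set ε : ℝ := 1 / ((k : ℝ) + 1) with hεdef
    have hεpos : 0 < ε := by positivity
    -- Markov's inequality: the mean variances tend to zero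
    have hbad : ξ {ρ | ¬ ∃ m, v m ρ < ε} = 0 := by
      have hle : ∀ m, ε * ξ.real {ρ | ¬ ∃ m, v m ρ < ε} ≤ ∫ ρ, v m ρ ∂ξ := by
        intro m
        have hsub : {ρ | ¬ ∃ m, v m ρ < ε} ⊆ {ρ | ε ≤ v m ρ} :=
          fun ρ hρ => not_lt.1 fun h => hρ ⟨m, h⟩
        exact (mul_le_mul_of_nonneg_left (measureReal_mono hsub) hεpos.le).trans
          (mul_meas_ge_le_integral_of_nonneg (hnonneg m)
            (integrable_continuousMap (v m).continuous ξ) ε)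
      have h0 := ge_of_tendsto' hv0 hle
      have h1 : ξ.real {ρ | ¬ ∃ m, v m ρ < ε} ≤ 0 := by
        by_contra h
        exact absurd h0 (not_le.2 (mul_pos hεpos (not_le.1 h)))
      exact (measureReal_eq_zero_iff).1 (le_antisymm h1 measureReal_nonneg)
    exact hbad
  filter_upwards [ae_all_iff.2 hε] with ρ hρ ε hε
  obtain ⟨k, hk⟩ := exists_nat_one_div_lt hε
  exact (hρ k).imp fun m hm => lt_trans hm hk

/-- Existence of the ergodic decomposition: restrict an ultrafilter limit of the laws of the empirical
measures to the invariant measures, which carry it. -/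
theorem exists_isChoquetMeasure [Nonempty Ω] (μ : InvMeasure Ω) : ∃ ξ, IsChoquetMeasure μ ξ := by
  let U : Ultrafilter ℕ := hyperfilter ℕ
  have hU : (U : Filter ℕ) ≤ atTop := Nat.hyperfilter_le_atTop
  obtain ⟨ξ, hξ, hlim⟩ := exists_limit_law μ.toMeasure U
  have he := (InvMeasure.isClosedEmbedding_toStringMeasure (Ω := Ω)).measurableEmbedding
  have hinv := ae_mem_range_of_limit_law hU hlim
  have hmap : (ξ.comap InvMeasure.toStringMeasure).map InvMeasure.toStringMeasure = ξ := by
    rw [he.map_comap, Measure.restrict_eq_self_of_ae_mem hinv]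
  refine ⟨ξ.comap InvMeasure.toStringMeasure, ?_, ?_, fun f => ?_⟩
  · constructor
    rw [← preimage_univ (f := InvMeasure.toStringMeasure), ← he.map_apply, hmap, measure_univ]
  · have h1 : ∀ᵐ ρ ∂((ξ.comap InvMeasure.toStringMeasure).map InvMeasure.toStringMeasure),
        ∀ i, ∀ ε > 0, ∃ m,
          ∫ σ, average m (TopologicalSpace.denseSeq C(Strings Ω, ℝ) i) σ ^ 2 ∂ρ.toMeasure
            - (∫ σ, TopologicalSpace.denseSeq C(Strings Ω, ℝ) i σ ∂ρ.toMeasure) ^ 2 < ε := by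
      rw [hmap]
      exact ae_all_iff.2 fun i => ae_average_variance_small_of_limit_law hU hlim _
    have h2 := he.ae_map_iff.1 h1
    refine measure_eq_zero_iff_ae_notMem.2 (h2.mono fun ν hν => ?_)
    exact not_not.2 (mem_ergodicMeasures_iff.2 hν)
  · have h1 : ∫ ν, (∫ σ, f σ ∂ν.toMeasure) ∂(ξ.comap InvMeasure.toStringMeasure)
        = ∫ ρ, evaluation f ρ ∂ξ := by
      conv_rhs => rw [← hmap, he.integral_map]
      rfl
    rw [h1]
    refine tendsto_nhds_unique ?_ (hlim (evaluation f))
    simp only [evaluation_empirical, μ.integral_average]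
    exact tendsto_const_nhds

theorem isChoquetMeasure_choquetMeasure [Nonempty Ω] (μ : InvMeasure Ω) :
    IsChoquetMeasure μ (choquetMeasure μ) :=
  Classical.epsilon_spec (exists_isChoquetMeasure μ)

/-! ### Affine minorants and Jensen's inequality -/

theorem InvMeasure.continuous_toDual : Continuous (InvMeasure.toDual (Ω := Ω)) :=
  WeakDual.continuous_of_continuous_eval fun f => InvMeasure.continuous_integral f

theorem InvMeasure.toDual_injective : Function.Injective (InvMeasure.toDual (Ω := Ω)) :=
  fun _ _ h => InvMeasure.ext_integral fun f => DFunLike.congr_fun h f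

theorem InvMeasure.toDual_mix (t : unitInterval) (μ ν : InvMeasure Ω) :
    (InvMeasure.mix t μ ν).toDual = (t : ℝ) • μ.toDual + (1 - t : ℝ) • ν.toDual :=
  DFunLike.ext _ _ fun f => integral_mix t μ ν f

instance : LocallyConvexSpace ℝ (WeakDual ℝ C(Strings Ω, ℝ)) :=
  inferInstanceAs (LocallyConvexSpace ℝ (WeakBilin (topDualPairing ℝ C(Strings Ω, ℝ))))

/-- Weak* continuous linear functionals on the dual of a normed space are evaluations. -/
theorem exists_eq_eval_of_weakDual {E : Type*} [NormedAddCommGroup E] [NormedSpace ℝ E]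
    (L : WeakDual ℝ E →L[ℝ] ℝ) : ∃ x : E, ∀ ℓ : WeakDual ℝ E, L ℓ = ℓ x := by
  obtain ⟨x, hx⟩ := LinearMap.dualEmbedding_surjective (topDualPairing ℝ E) L
  exact ⟨x, fun ℓ => (DFunLike.congr_fun hx ℓ).symm⟩

/-- A continuous convex function on `𝒫(T)` is the supremum of its minorants `ν ↦ ∫ f dν + c`:
the epigraph is closed and convex, so it can be separated from a point below the graph. -/
theorem exists_affine_minorant [Nonempty Ω] {h : InvMeasure Ω → ℝ} (hc : Continuous h)
    (hconv : IsConvex h) (μ : InvMeasure Ω) {ε : ℝ} (hε : 0 < ε) :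
    ∃ (f : C(Strings Ω, ℝ)) (c : ℝ), (∀ ν : InvMeasure Ω, ∫ σ, f σ ∂ν.toMeasure + c ≤ h ν) ∧
      h μ - ε < ∫ σ, f σ ∂μ.toMeasure + c := by
  let j : InvMeasure Ω × ℝ → WeakDual ℝ C(Strings Ω, ℝ) × ℝ := Prod.map InvMeasure.toDual id
  have hj : IsClosedEmbedding j :=
    (InvMeasure.continuous_toDual.isClosedEmbedding InvMeasure.toDual_injective).prodMap .id
  let epi : Set (InvMeasure Ω × ℝ) := {p | h p.1 ≤ p.2}
  have hclosed : IsClosed (j '' epi) :=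
    hj.isClosedMap _ (isClosed_le (hc.comp continuous_fst) continuous_snd)
  have hconvex : Convex ℝ (j '' epi) := by
    rintro _ ⟨⟨μ₁, r₁⟩, h₁, rfl⟩ _ ⟨⟨μ₂, r₂⟩, h₂, rfl⟩ a b ha hb hab
    obtain rfl : b = 1 - a := by linarith
    let t : unitInterval := ⟨a, ha, by linarith⟩
    refine ⟨(InvMeasure.mix t μ₁ μ₂, a * r₁ + (1 - a) * r₂), ?_, ?_⟩
    · refine (hconv t μ₁ μ₂).trans ?_
      exact add_le_add (mul_le_mul_of_nonneg_left h₁ ha) (mul_le_mul_of_nonneg_left h₂ hb)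
    · exact Prod.ext (InvMeasure.toDual_mix t μ₁ μ₂) rfl
  have hnot : ((μ.toDual, h μ - ε) : WeakDual ℝ C(Strings Ω, ℝ) × ℝ) ∉ j '' epi := by
    rintro ⟨⟨ν, r⟩, hr, heq⟩
    obtain rfl : ν = μ := InvMeasure.toDual_injective (congrArg Prod.fst heq)
    obtain rfl : r = h ν - ε := congrArg Prod.snd heq
    have : h ν ≤ h ν - ε := hr
    linarith
  obtain ⟨Φ, u, hu, hΦ⟩ := geometric_hahn_banach_point_closed hconvex hclosed hnot
  obtain ⟨g, hg⟩ := exists_eq_eval_of_weakDual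
    (Φ.comp (ContinuousLinearMap.inl ℝ (WeakDual ℝ C(Strings Ω, ℝ)) ℝ))
  set a := Φ (0, 1) with ha
  have hsplit : ∀ (ν : InvMeasure Ω) (r : ℝ),
      Φ (ν.toDual, r) = ∫ σ, g σ ∂ν.toMeasure + r * a := by
    intro ν r
    have h1 : ((ν.toDual, r) : WeakDual ℝ C(Strings Ω, ℝ) × ℝ) = (ν.toDual, 0) + r • (0, 1) := by
      simp
    rw [h1, map_add, map_smul, ← ha, smul_eq_mul]
    congr 1
    exact hg ν.toDual
  have hepi : ∀ ν, u < ∫ σ, g σ ∂ν.toMeasure + h ν * a := fun ν => by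
    rw [← hsplit]
    exact hΦ _ ⟨(ν, h ν), le_refl (h ν), rfl⟩
  rw [hsplit] at hu
  -- the separating hyperplane is not vertical: it passes strictly between two points over `μ`
  have hapos : 0 < a := by
    have := hepi μ
    by_contra! hle
    nlinarith [mul_nonneg_of_nonpos_of_nonpos hle (neg_nonpos.2 hε.le)]
  have hint : ∀ ν : InvMeasure Ω, ∫ σ, ((-a⁻¹) • g) σ ∂ν.toMeasure + u / a
      = (u - ∫ σ, g σ ∂ν.toMeasure) / a := by
    intro ν
    have : ∫ σ, ((-a⁻¹) • g) σ ∂ν.toMeasure = -a⁻¹ * ∫ σ, g σ ∂ν.toMeasure :=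
      integral_const_mul _ _
    rw [this]
    ring
  refine ⟨(-a⁻¹) • g, u / a, fun ν => ?_, ?_⟩
  · rw [hint, div_le_iff₀ hapos]
    linarith [hepi ν]
  · rw [hint, lt_div_iff₀ hapos]
    linarith

theorem integral_affine_of_barycenter [Nonempty Ω] {μ : InvMeasure Ω} {ξ : Measure (InvMeasure Ω)}
    (hξ : IsChoquetMeasure μ ξ) (f : C(Strings Ω, ℝ)) (c : ℝ) :
    ∫ ν, (∫ σ, f σ ∂ν.toMeasure + c) ∂ξ = ∫ σ, f σ ∂μ.toMeasure + c := by
  have := hξ.1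
  rw [integral_add (integrable_continuousMap (InvMeasure.continuous_integral f) ξ)
    (integrable_const _), ← hξ.2.2 f]
  simp

/-- Jensen's inequality for Choquet measures. -/
theorem IsChoquetMeasure.le_integral [Nonempty Ω] {μ : InvMeasure Ω} {ξ : Measure (InvMeasure Ω)}
    (hξ : IsChoquetMeasure μ ξ) {h : InvMeasure Ω → ℝ} (hc : Continuous h) (hconv : IsConvex h) :
    h μ ≤ ∫ ν, h ν ∂ξ := by
  have := hξ.1
  refine le_of_forall_pos_lt_add fun ε hε => ?_
  obtain ⟨f, c, hle, hlt⟩ := exists_affine_minorant hc hconv μ hε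
  have h1 : ∫ ν, (∫ σ, f σ ∂ν.toMeasure + c) ∂ξ ≤ ∫ ν, h ν ∂ξ :=
    integral_mono (integrable_continuousMap ((InvMeasure.continuous_integral f).add
      continuous_const) ξ) (integrable_continuousMap hc ξ) hle
  rw [integral_affine_of_barycenter hξ] at h1
  linarith

/-- Continuous affine functions are evaluated at the barycenter. -/
theorem IsChoquetMeasure.integral_eq_of_isAffine [Nonempty Ω] {μ : InvMeasure Ω}
    {ξ : Measure (InvMeasure Ω)} (hξ : IsChoquetMeasure μ ξ) {h : InvMeasure Ω → ℝ}
    (hc : Continuous h) (ha : IsAffine h) : ∫ ν, h ν ∂ξ = h μ := by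
  refine le_antisymm ?_ (hξ.le_integral hc fun t μ ν => (ha t μ ν).le)
  have h1 := hξ.le_integral (h := fun ν => -h ν) hc.neg fun t μ ν => by
    simp only [ha t μ ν]
    linarith
  rw [integral_neg] at h1
  linarith

/-! ### The functional as a decreasing limit of integrals of continuous functions -/

theorem average_double (n : ℕ) (f : C(Strings Ω, ℝ)) (σ : Strings Ω) :
    average (2 * n + 1) f σ
      = 1 / 2 * average n f σ + (1 - 1 / 2) * average n f ((shift Ω)^[n + 1] σ) := by
  simp only [average_apply]
  have h : ∑ i ∈ Finset.range (2 * n + 1 + 1), f ((shift Ω)^[i] σ)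
      = ∑ i ∈ Finset.range (n + 1), f ((shift Ω)^[i] σ)
        + ∑ i ∈ Finset.range (n + 1), f ((shift Ω)^[i] ((shift Ω)^[n + 1] σ)) := by
    rw [show 2 * n + 1 + 1 = (n + 1) + (n + 1) by ring, Finset.sum_range_add]
    congr 1
    refine Finset.sum_congr rfl fun i _ => ?_
    rw [← Function.iterate_add_apply, add_comm]
  rw [h]
  have h2 : ((2 * n + 1 : ℕ) : ℝ) + 1 = 2 * ((n : ℝ) + 1) := by push_cast; ring
  rw [h2, mul_inv]
  ring

/-- The continuous function `σ ↦ F(ρ_S)`, where `ρ` is the empirical measure of length `2 ^ k`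
at `σ`. Powers of two make the integrals against invariant measures monotone. -/
def blockFunction {F : BoundedMeasurable Ω → ℝ} (hF : SigmaNormal F) (k : ℕ) :
    C(Strings Ω, ℝ) :=
  ⟨fun σ => F (empirical (2 ^ k - 1) σ).onS,
    hF.continuous_stringMeasure.comp (continuous_empirical _)⟩

theorem antitone_integral_blockFunction {F : BoundedMeasurable Ω → ℝ} (hconv : ConvexOn ℝ univ F)
    (hF : SigmaNormal F) (μ : InvMeasure Ω) :
    Antitone fun k => ∫ σ, blockFunction hF k σ ∂μ.toMeasure := by
  refine antitone_nat_of_succ_le fun k => ?_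
  set n := 2 ^ k - 1 with hn
  have hn' : 2 ^ (k + 1) - 1 = 2 * n + 1 := by
    have := Nat.one_le_two_pow (n := k)
    omega
  have h1 : ∀ σ, blockFunction hF (k + 1) σ
      ≤ 1 / 2 * blockFunction hF k σ
        + (1 - 1 / 2) * blockFunction hF k ((shift Ω)^[n + 1] σ) := by
    intro σ
    change F (empirical (2 ^ (k + 1) - 1) σ).onS ≤ _
    rw [hn']
    refine le_of_integral_eq_convex_combination hconv (by norm_num) (by norm_num) fun f => ?_
    simp only [integral_empirical]
    exact average_double n f σ
  have i1 : Integrable (fun σ => 1 / 2 * blockFunction hF k σ) μ.toMeasure :=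
    (integrable_continuousMap (blockFunction hF k).continuous _).const_mul _
  have i2 : Integrable (fun σ => (1 - 1 / 2 : ℝ) * blockFunction hF k ((shift Ω)^[n + 1] σ))
      μ.toMeasure :=
    (integrable_continuousMap ((blockFunction hF k).continuous.comp
      (continuous_shift.iterate _)) _).const_mul _
  have h2 := integral_mono (integrable_continuousMap (blockFunction hF (k + 1)).continuous
    μ.toMeasure) (i1.add i2) h1
  refine h2.trans (le_of_eq ?_)
  change ∫ σ, (1 / 2 * blockFunction hF k σ
    + (1 - 1 / 2 : ℝ) * blockFunction hF k ((shift Ω)^[n + 1] σ)) ∂μ.toMeasure = _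
  rw [integral_add i1 i2, integral_const_mul, integral_const_mul, μ.integral_comp_iterate]
  ring

theorem delta_eq_integral [Nonempty Ω] (F : BoundedMeasurable Ω → ℝ) (μ : InvMeasure Ω) :
    Delta F μ = ∫ ν, F ν.onS ∂(choquetMeasure μ) := by
  have h : ∀ᵐ ν ∂(choquetMeasure μ), ν ∈ ergodicMeasures Ω :=
    (measure_eq_zero_iff_ae_notMem.1 (isChoquetMeasure_choquetMeasure μ).2.1).mono
      fun ν hν => not_notMem.1 hν
  rw [Delta, Measure.restrict_eq_self_of_ae_mem h]

theorem tendsto_integral_blockFunction [Nonempty Ω] {F : BoundedMeasurable Ω → ℝ}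
    (hF : SigmaNormal F) (μ : InvMeasure Ω) :
    Tendsto (fun k => ∫ σ, blockFunction hF k σ ∂μ.toMeasure) atTop (𝓝 (Delta F μ)) := by
  rw [delta_eq_integral]
  have h := (isChoquetMeasure_choquetMeasure μ).tendsto_integral_empirical
    ⟨fun ρ => F ρ.onS, hF.continuous_stringMeasure⟩
  have h2 : Tendsto (fun k : ℕ => 2 ^ k - 1) atTop atTop :=
    (tendsto_sub_atTop_nat 1).comp (tendsto_pow_atTop_atTop_of_one_lt one_lt_two)
  exact h.comp h2

theorem isAffine_delta [Nonempty Ω] {F : BoundedMeasurable Ω → ℝ} (hF : SigmaNormal F) :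
    IsAffine (Delta F) := by
  intro t μ ν
  refine tendsto_nhds_unique (tendsto_integral_blockFunction hF _) ?_
  simp only [integral_mix]
  exact ((tendsto_integral_blockFunction hF μ).const_mul _).add
    ((tendsto_integral_blockFunction hF ν).const_mul _)

theorem upperSemicontinuous_delta [Nonempty Ω] {F : BoundedMeasurable Ω → ℝ}
    (hconv : ConvexOn ℝ univ F) (hF : SigmaNormal F) : UpperSemicontinuous (Delta F) := by
  intro μ y hy
  obtain ⟨k, hk⟩ := ((tendsto_integral_blockFunction hF μ).eventually_lt_const hy).exists
  filter_upwards [(InvMeasure.continuous_integral (blockFunction hF k)).continuousAt.eventually_lt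
    continuousAt_const hk] with ν hν
  exact ((antitone_integral_blockFunction hconv hF ν).le_of_tendsto
    (tendsto_integral_blockFunction hF ν) k).trans_lt hν

theorem isChoquetMeasure_dirac [Nonempty Ω] {ν : InvMeasure Ω} (hν : ν ∈ ergodicMeasures Ω) :
    IsChoquetMeasure ν (Measure.dirac ν) := by
  refine ⟨inferInstance, ?_, fun f => ?_⟩
  · rw [Measure.dirac_apply' _ measurableSet_ergodicMeasures.compl]
    simp [hν]
  · rw [integral_dirac]

theorem delta_eq_of_ergodic [Nonempty Ω] (F : BoundedMeasurable Ω → ℝ) {ν : InvMeasure Ω}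
    (hν : ν ∈ ergodicMeasures Ω) : Delta F ν = F ν.onS := by
  rw [delta_eq_integral, (isChoquetMeasure_choquetMeasure ν).unique (isChoquetMeasure_dirac hν),
    integral_dirac]

theorem le_delta [Nonempty Ω] {F : BoundedMeasurable Ω → ℝ} (hconv : ConvexOn ℝ univ F)
    (hF : SigmaNormal F) (μ : InvMeasure Ω) : F μ.onS ≤ Delta F μ := by
  rw [delta_eq_integral]
  exact (isChoquetMeasure_choquetMeasure μ).le_integral hF.continuous_invMeasure
    (isConvex_onS hconv)

theorem delta_eq_of_isAffine [Nonempty Ω] {F : BoundedMeasurable Ω → ℝ} (hF : SigmaNormal F)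
    (ha : IsAffine fun μ : InvMeasure Ω => F μ.onS) (μ : InvMeasure Ω) :
    Delta F μ = F μ.onS := by
  rw [delta_eq_integral]
  exact (isChoquetMeasure_choquetMeasure μ).integral_eq_of_isAffine hF.continuous_invMeasure ha

theorem continuousAt_delta_of_ergodic [Nonempty Ω] {F : BoundedMeasurable Ω → ℝ}
    (hconv : ConvexOn ℝ univ F) (hF : SigmaNormal F) {ν : InvMeasure Ω}
    (hν : ν ∈ ergodicMeasures Ω) : ContinuousAt (Delta F) ν := by
  refine continuousAt_iff_lower_upperSemicontinuousAt.2
    ⟨fun y hy => ?_, upperSemicontinuous_delta hconv hF ν⟩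
  change y < Delta F ν at hy
  rw [delta_eq_of_ergodic F hν] at hy
  filter_upwards [continuousAt_const.eventually_lt hF.continuous_invMeasure.continuousAt hy]
    with μ hμ
  exact hμ.trans_le (le_delta hconv hF μ)

/-! ### Integral representation of uniform limits -/

/-- If `f` has small integrals against all invariant measures, some Birkhoff average of `f` is
uniformly small: otherwise empirical measures at bad points accumulate at an invariant measure with
a large integral. -/
theorem exists_norm_average_lt [Nonempty Ω] {f : C(Strings Ω, ℝ)} {ε : ℝ} (hε : 0 < ε)
    (h : ∀ ν : InvMeasure Ω, |∫ σ, f σ ∂ν.toMeasure| < ε) : ∃ n, ‖average n f‖ < ε := by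
  by_contra! hcon
  have hbad : ∀ n, ∃ σ, ε ≤ |average n f σ| := by
    intro n
    by_contra! hlt
    exact absurd ((ContinuousMap.norm_lt_iff _ hε).2 hlt) (not_lt.2 (hcon n))
  choose σ hσ using hbad
  let U : Ultrafilter ℕ := hyperfilter ℕ
  have hU : (U : Filter ℕ) ≤ atTop := Nat.hyperfilter_le_atTop
  obtain ⟨ρ, -, hρ⟩ := isCompact_univ.ultrafilter_le_nhds
    (U.map fun n => empirical n (σ n)) (by simp)
  have hlim := StringMeasure.tendsto_iff.1 (show Tendsto (fun n => empirical n (σ n)) U (𝓝 ρ)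
    from hρ)
  simp only [integral_empirical] at hlim
  obtain ⟨ν, rfl⟩ : ρ ∈ range (InvMeasure.toStringMeasure (Ω := Ω)) := by
    refine StringMeasure.mem_range_of_denseSeq fun i => ?_
    set g := TopologicalSpace.denseSeq C(Strings Ω, ℝ) i
    refine sub_eq_zero.1 (tendsto_nhds_unique ((hlim (compShift g)).sub (hlim g)) ?_)
    have h2 : Tendsto (fun n : ℕ => 2 * ‖g‖ * ((n : ℝ) + 1)⁻¹) atTop (𝓝 0) := by
      have := (tendsto_one_div_add_atTop_nhds_zero_nat (𝕜 := ℝ)).const_mul (2 * ‖g‖)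
      simpa using this
    exact squeeze_zero_norm (fun n => abs_average_compShift_sub_le n g (σ n)) (h2.mono_left hU)
  exact absurd (h ν) (not_lt.2 (ge_of_tendsto' (hlim f).abs hσ))

/-- Uniform limits of `μ ↦ ∫ fₖ dμ` on `𝒫(T)` are again integrals of a continuous function: after
replacing increments by Birkhoff averages, which changes no integral, the series of increments
converges in norm. -/
theorem exists_integral_eq_of_tendstoUniformly [Nonempty Ω] {f : ℕ → C(Strings Ω, ℝ)}
    {G : InvMeasure Ω → ℝ}
    (h : TendstoUniformly (fun k (μ : InvMeasure Ω) => ∫ σ, f k σ ∂μ.toMeasure) G atTop) :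
    ∃ g : C(Strings Ω, ℝ), ∀ μ : InvMeasure Ω, G μ = ∫ σ, g σ ∂μ.toMeasure := by
  have hk : ∀ j : ℕ, ∃ k ≥ j, ∀ μ : InvMeasure Ω,
      |G μ - ∫ σ, f k σ ∂μ.toMeasure| < (1 / 2) ^ j := by
    intro j
    have h1 := Metric.tendstoUniformly_iff.1 h ((1 / 2 : ℝ) ^ j) (by positivity)
    obtain ⟨k, hk1, hk2⟩ := (h1.and (eventually_ge_atTop j)).exists
    exact ⟨k, hk2, fun μ => by simpa [Real.dist_eq] using hk1 μ⟩
  choose k hkj hk using hk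
  -- averaging makes the increments geometrically small in norm and keeps their integrals
  have hd : ∀ j, ∃ n, ‖average n (f (k (j + 1)) - f (k j))‖ < 2 * (1 / 2) ^ j := by
    intro j
    refine exists_norm_average_lt (by positivity) fun ν => ?_
    have h1 : ∫ σ, (f (k (j + 1)) - f (k j)) σ ∂ν.toMeasure
        = ∫ σ, f (k (j + 1)) σ ∂ν.toMeasure - ∫ σ, f (k j) σ ∂ν.toMeasure :=
      integral_sub (integrable_continuousMap (f (k (j + 1))).continuous _)
        (integrable_continuousMap (f (k j)).continuous _)
    have h2 := hk (j + 1) ν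
    have h3 := hk j ν
    have h4 : (1 / 2 : ℝ) ^ (j + 1) ≤ (1 / 2) ^ j :=
      pow_le_pow_of_le_one (by norm_num) (by norm_num) (Nat.le_succ j)
    rw [h1]
    rw [abs_lt] at h2 h3 ⊢
    constructor <;> linarith
  choose n hn using hd
  let d : ℕ → C(Strings Ω, ℝ) := fun j => average (n j) (f (k (j + 1)) - f (k j))
  have hsum : Summable d := by
    refine Summable.of_norm_bounded (g := fun j => 2 * (1 / 2 : ℝ) ^ j) ?_ fun j => (hn j).le
    exact (summable_geometric_of_lt_one (by norm_num) (by norm_num)).mul_left 2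
  refine ⟨f (k 0) + ∑' j, d j, fun μ => ?_⟩
  have hpartial : ∀ m, ∫ σ, (f (k 0) + ∑ j ∈ Finset.range m, d j) σ ∂μ.toMeasure
      = ∫ σ, f (k m) σ ∂μ.toMeasure := by
    intro m
    change μ.toDual (f (k 0) + ∑ j ∈ Finset.range m, d j) = μ.toDual (f (k m))
    have hdj : ∀ j, μ.toDual (d j) = μ.toDual (f (k (j + 1))) - μ.toDual (f (k j)) := fun j => by
      rw [← map_sub]
      exact μ.integral_average _ _
    rw [map_add, map_sum]
    simp only [hdj]
    rw [Finset.sum_range_sub (fun j => μ.toDual (f (k j)))]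
    ring
  have hlim1 : Tendsto (fun m => ∫ σ, f (k m) σ ∂μ.toMeasure) atTop
      (𝓝 (∫ σ, (f (k 0) + ∑' j, d j) σ ∂μ.toMeasure)) := by
    simp only [← hpartial]
    exact ((continuous_integral_measure μ.toMeasure).tendsto _).comp
      (hsum.hasSum.tendsto_sum_nat.const_add (f (k 0)))
  have hlim2 : Tendsto (fun m => ∫ σ, f (k m) σ ∂μ.toMeasure) atTop (𝓝 (G μ)) :=
    (h.tendsto_at μ).comp (tendsto_atTop_mono hkj tendsto_id)
  exact tendsto_nhds_unique hlim2 hlim1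

/-- By Dini's theorem a continuous `Δ^F` is the uniform limit of its block approximations. -/
theorem exists_integral_eq_delta [Nonempty Ω] {F : BoundedMeasurable Ω → ℝ}
    (hconv : ConvexOn ℝ univ F) (hF : SigmaNormal F) (hc : Continuous (Delta F)) :
    ∃ f : C(Strings Ω, ℝ), ∀ μ : InvMeasure Ω, Delta F μ = ∫ σ, f σ ∂μ.toMeasure :=
  exists_integral_eq_of_tendstoUniformly (f := blockFunction hF)
    (Antitone.tendstoUniformly_of_forall_tendsto
      (fun k => InvMeasure.continuous_integral (blockFunction hF k))
      (fun _ _ hij μ => antitone_integral_blockFunction hconv hF μ hij) hc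
      (tendsto_integral_blockFunction hF))

/-! ### Density of the ergodic measures -/

theorem shift_iterate_apply (i : ℕ) (σ : Strings Ω) (t : ℕ) :
    (shift Ω)^[i] σ t = σ (t + i) := by
  induction i generalizing σ with
  | zero => rfl
  | succ i ih =>
    rw [Function.iterate_succ_apply, ih]
    rfl

theorem average_eq_of_periodic {n : ℕ} {σ : Strings Ω} (h : (shift Ω)^[n + 1] σ = σ)
    (f : C(Strings Ω, ℝ)) (i : ℕ) : average n f ((shift Ω)^[i] σ) = average n f σ := by
  induction i with
  | zero => rfl
  | succ i ih =>
    rw [← ih, Function.iterate_succ_apply']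
    have h1 := average_compShift_sub n f ((shift Ω)^[i] σ)
    rw [← Function.iterate_add_apply, add_comm (n + 1) i, Function.iterate_add_apply, h, sub_self,
      mul_zero] at h1
    rw [← sub_eq_zero.1 h1]
    generalize (shift Ω)^[i] σ = τ
    simp only [average_apply, compShift_apply, ← Function.iterate_succ_apply',
      Function.iterate_succ_apply]

/-- The orbit measure of a periodic string is invariant and ergodic. -/
theorem exists_ergodic_eq_empirical [Nonempty Ω] {n : ℕ} {σ : Strings Ω}
    (h : (shift Ω)^[n + 1] σ = σ) :
    ∃ ν ∈ ergodicMeasures Ω, ν.toStringMeasure = empirical n σ := by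
  obtain ⟨ν, hν⟩ : empirical n σ ∈ range (InvMeasure.toStringMeasure (Ω := Ω)) := by
    refine StringMeasure.mem_range_of_denseSeq fun i => ?_
    rw [integral_empirical, integral_empirical, ← sub_eq_zero, average_compShift_sub, h, sub_self,
      mul_zero]
  have hint : ∀ f : C(Strings Ω, ℝ), ∫ τ, f τ ∂ν.toMeasure = average n f σ := fun f => by
    rw [← integral_empirical, ← hν]
    rfl
  refine ⟨ν, mem_ergodicMeasures_iff.2 fun i ε hε => ⟨n, ?_⟩, hν⟩
  set f := TopologicalSpace.denseSeq C(Strings Ω, ℝ) i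
  -- the `n`-th Birkhoff average is constant along the orbit
  have h1 : ∫ τ, average n f τ ^ 2 ∂ν.toMeasure = average n f σ ^ 2 := by
    refine (hint (average n f ^ 2)).trans ?_
    rw [average_apply]
    simp only [ContinuousMap.pow_apply, average_eq_of_periodic h, Finset.sum_const,
      Finset.card_range, nsmul_eq_mul]
    push_cast
    field_simp
  rw [h1, hint, sub_self]
  exact hε

/-- A continuous function on `Σ` depends on finitely many coordinates up to `ε`. -/
theorem exists_coordinates_bound [Nonempty Ω] (f : C(Strings Ω, ℝ)) {ε : ℝ} (hε : 0 < ε) :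
    ∃ L : ℕ, ∀ σ τ : Strings Ω, (∀ i < L, σ i = τ i) → |f σ - f τ| < ε := by
  by_contra! h
  choose σ τ hστ hf using h
  let U : Ultrafilter ℕ := hyperfilter ℕ
  have hU : (U : Filter ℕ) ≤ atTop := Nat.hyperfilter_le_atTop
  obtain ⟨x, -, hx⟩ := isCompact_univ.ultrafilter_le_nhds (U.map σ) (by simp)
  obtain ⟨y, -, hy⟩ := isCompact_univ.ultrafilter_le_nhds (U.map τ) (by simp)
  replace hx : Tendsto σ U (𝓝 x) := hx
  replace hy : Tendsto τ U (𝓝 y) := hy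
  obtain rfl : x = y := by
    funext i
    refine tendsto_nhds_unique (((continuous_apply i).tendsto x).comp hx)
      ((((continuous_apply i).tendsto y).comp hy).congr' ?_)
    filter_upwards [hU (eventually_gt_atTop i)] with L hL
    exact (hστ L i hL).symm
  have h0 := (((f.continuous.tendsto x).comp hx).sub ((f.continuous.tendsto x).comp hy)).abs
  rw [sub_self, abs_zero] at h0
  exact absurd (ge_of_tendsto' h0 hf) (not_le.2 hε)

/-- By the strong law of large numbers, the integrals of finitely many functions are approximated
by means over a common finite sample. -/
theorem exists_sample (μ : Measure (Strings Ω)) [IsProbabilityMeasure μ]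
    (s : Finset C(Strings Ω, ℝ)) {ε : ℝ} (hε : 0 < ε) :
    ∃ (m : ℕ) (ω : ℕ → Strings Ω), 0 < m ∧ ∀ f ∈ s,
      |(∑ j ∈ Finset.range m, f (ω j)) / m - ∫ σ, f σ ∂μ| < ε := by
  let P : Measure (ℕ → Strings Ω) := Measure.infinitePi fun _ => μ
  have hlaw : ∀ f : C(Strings Ω, ℝ), ∀ᵐ ω ∂P,
      Tendsto (fun m : ℕ => (∑ j ∈ Finset.range m, f (ω j)) / m) atTop (𝓝 (∫ σ, f σ ∂μ)) := by
    intro f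
    have hmp : ∀ i, MeasurePreserving (fun ω : ℕ → Strings Ω => ω i) P μ :=
      fun i => measurePreserving_eval_infinitePi (fun _ => μ) i
    have hmean : ∫ ω, f (ω 0) ∂P = ∫ σ, f σ ∂μ := by
      rw [← (hmp 0).map_eq,
        integral_map (hmp 0).measurable.aemeasurable f.continuous.aestronglyMeasurable]
    rw [← hmean]
    refine ProbabilityTheory.strong_law_ae_real (fun i (ω : ℕ → Strings Ω) => f (ω i)) ?_ ?_ ?_
    · exact ((hmp 0).integrable_comp f.continuous.aestronglyMeasurable).2
        (integrable_continuousMap f.continuous μ)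
    · intro i j hij
      exact (ProbabilityTheory.iIndepFun_infinitePi (P := fun _ : ℕ => μ)
        (X := fun _ => f) (fun _ => f.continuous.measurable)).indepFun hij
    · intro i
      refine ⟨(f.continuous.measurable.comp (hmp i).measurable).aemeasurable,
        (f.continuous.measurable.comp (hmp 0).measurable).aemeasurable, ?_⟩
      change P.map (f ∘ fun ω => ω i) = P.map (f ∘ fun ω => ω 0)
      rw [← Measure.map_map f.continuous.measurable (hmp i).measurable, (hmp i).map_eq,
        ← Measure.map_map f.continuous.measurable (hmp 0).measurable, (hmp 0).map_eq]
  obtain ⟨ω, hω⟩ := ((Finset.eventually_all s).2 fun f _ => hlaw f).exists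
  have h1 : ∀ᶠ m : ℕ in atTop, ∀ f ∈ s,
      |(∑ j ∈ Finset.range m, f (ω j)) / m - ∫ σ, f σ ∂μ| < ε :=
    (Finset.eventually_all s).2 fun f hf => by
      simpa [Real.dist_eq] using Metric.tendsto_nhds.1 (hω f hf) ε hε
  obtain ⟨m, hm, hm0⟩ := (h1.and (eventually_gt_atTop 0)).exists
  exact ⟨m, ω, hm0, hm⟩

/-- The periodic string obtained by repeating the concatenation of the initial words of length `N`
of the strings `ω 0, …, ω (m - 1)`. -/
def concat (N m : ℕ) (ω : ℕ → Strings Ω) : Strings Ω := fun t => ω (t / N % m) (t % N)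

theorem concat_periodic {N m : ℕ} (hN : 0 < N) (ω : ℕ → Strings Ω) :
    (shift Ω)^[m * N] (concat N m ω) = concat N m ω := by
  funext t
  rw [shift_iterate_apply]
  simp only [concat, Nat.add_mul_mod_self_right, Nat.add_mul_div_right _ _ hN, Nat.add_mod_right]

theorem sum_range_mul {N m : ℕ} (g : ℕ → ℝ) : ∑ i ∈ Finset.range (m * N), g i
    = ∑ j ∈ Finset.range m, ∑ r ∈ Finset.range N, g (j * N + r) := by
  induction m with
  | zero => simp
  | succ m ih => rw [Nat.succ_mul, Finset.sum_range_add, ih, Finset.sum_range_succ]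

/-- Averages along a concatenation are the means of the averages along its pieces, up to the
effect of the `L` last positions in each word. -/
theorem abs_sum_concat_sub_le {N m L : ℕ} (ω : ℕ → Strings Ω)
    {f : C(Strings Ω, ℝ)} {ε : ℝ}
    (hL : ∀ σ τ : Strings Ω, (∀ i < L, σ i = τ i) → |f σ - f τ| < ε) :
    |∑ i ∈ Finset.range (m * N), f ((shift Ω)^[i] (concat N m ω))
      - ∑ j ∈ Finset.range m, ∑ r ∈ Finset.range N, f ((shift Ω)^[r] (ω j))|
      ≤ m * (N * ε + L * (2 * ‖f‖)) := by
  have hε : 0 ≤ ε := (abs_nonneg _).trans (hL (ω 0) (ω 0) fun _ _ => rfl).le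
  rw [sum_range_mul, ← Finset.sum_sub_distrib]
  refine (Finset.abs_sum_le_sum_abs _ _).trans ?_
  refine (Finset.sum_le_card_nsmul _ _ (N * ε + L * (2 * ‖f‖)) fun j hj => ?_).trans
    (le_of_eq (by rw [Finset.card_range, nsmul_eq_mul]))
  rw [← Finset.sum_sub_distrib]
  refine (Finset.abs_sum_le_sum_abs _ _).trans ?_
  have hterm : ∀ r ∈ Finset.range N,
      |f ((shift Ω)^[j * N + r] (concat N m ω)) - f ((shift Ω)^[r] (ω j))|
        ≤ ε + if N < r + L then 2 * ‖f‖ else 0 := by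
    intro r hr
    split_ifs with h
    · have h1 := f.norm_coe_le_norm ((shift Ω)^[j * N + r] (concat N m ω))
      have h2 := f.norm_coe_le_norm ((shift Ω)^[r] (ω j))
      have h3 := norm_sub_le (f ((shift Ω)^[j * N + r] (concat N m ω))) (f ((shift Ω)^[r] (ω j)))
      rw [Real.norm_eq_abs] at h3
      linarith
    · rw [add_zero]
      refine (hL _ _ fun i hi => ?_).le
      have hlt : i + r < N := by omega
      have h1 : i + (j * N + r) = (i + r) + j * N := by ring
      rw [shift_iterate_apply, shift_iterate_apply, concat, h1, Nat.add_mul_mod_self_right,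
        Nat.mod_eq_of_lt hlt, Nat.add_mul_div_right _ _ (by omega), Nat.div_eq_of_lt hlt, zero_add,
        Nat.mod_eq_of_lt (Finset.mem_range.1 hj)]
  refine (Finset.sum_le_sum hterm).trans ?_
  rw [Finset.sum_add_distrib, Finset.sum_const, Finset.card_range, nsmul_eq_mul,
    ← Finset.sum_filter, Finset.sum_const, nsmul_eq_mul]
  gcongr
  have hsub : (Finset.range N).filter (fun r => N < r + L) ⊆ Finset.Ico (N - L) N := by
    intro r hr
    rw [Finset.mem_filter, Finset.mem_range] at hr
    rw [Finset.mem_Ico]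
    omega
  refine (Finset.card_le_card hsub).trans ?_
  rw [Nat.card_Ico]
  omega

/-- Every invariant measure is approximated by ergodic ones on finitely many test functions:
sample finitely many long words from `μ` and take the orbit measure of their periodic
concatenation. -/
theorem exists_ergodic_near [Nonempty Ω] (μ : InvMeasure Ω) (s : Finset C(Strings Ω, ℝ)) {ε : ℝ}
    (hε : 0 < ε) : ∃ ν ∈ ergodicMeasures Ω, ∀ f ∈ s,
      |∫ σ, f σ ∂ν.toMeasure - ∫ σ, f σ ∂μ.toMeasure| < ε := by
  classical
  choose L hL using fun f : C(Strings Ω, ℝ) => exists_coordinates_bound f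
    (show (0 : ℝ) < ε / 3 by positivity)
  have hev : ∀ᶠ n : ℕ in atTop, ∀ f ∈ s, L f * (2 * ‖f‖) * (1 / ((n : ℝ) + 1)) < ε / 3 := by
    refine (Finset.eventually_all s).2 fun f _ => ?_
    have := (tendsto_one_div_add_atTop_nhds_zero_nat (𝕜 := ℝ)).const_mul (L f * (2 * ‖f‖))
    rw [mul_zero] at this
    exact this.eventually_lt_const (by positivity)
  obtain ⟨n, hn⟩ := hev.exists
  obtain ⟨m, ω, hm, hω⟩ := exists_sample μ.toMeasure (s.image (average n))
    (show (0 : ℝ) < ε / 3 by positivity)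
  have hpos : 0 < m * (n + 1) := by positivity
  have hq : m * (n + 1) - 1 + 1 = m * (n + 1) := Nat.sub_add_cancel hpos
  obtain ⟨ν, hν, hνe⟩ := exists_ergodic_eq_empirical (n := m * (n + 1) - 1)
    (σ := concat (n + 1) m ω) (by rw [hq]; exact concat_periodic n.succ_pos ω)
  refine ⟨ν, hν, fun f hf => ?_⟩
  have hm' : (0 : ℝ) < m := by exact_mod_cast hm
  have hn' : (0 : ℝ) < (n : ℝ) + 1 := by positivity
  have h1 : ∫ σ, f σ ∂ν.toMeasure = ((m : ℝ) * ((n : ℝ) + 1))⁻¹ *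
      ∑ i ∈ Finset.range (m * (n + 1)), f ((shift Ω)^[i] (concat (n + 1) m ω)) := by
    have h2 : ∫ σ, f σ ∂ν.toMeasure = average (m * (n + 1) - 1) f (concat (n + 1) m ω) := by
      rw [← integral_empirical, ← hνe]
      rfl
    rw [h2, average_apply, hq]
    congr 2
    exact_mod_cast hq
  have h2 := hω _ (Finset.mem_image_of_mem _ hf)
  rw [μ.integral_average] at h2
  have h3 : (∑ j ∈ Finset.range m, average n f (ω j)) / m = ((m : ℝ) * ((n : ℝ) + 1))⁻¹ *
      ∑ j ∈ Finset.range m, ∑ r ∈ Finset.range (n + 1), f ((shift Ω)^[r] (ω j)) := by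
    simp only [average_apply]
    rw [← Finset.mul_sum]
    field_simp
  have h4 := abs_sum_concat_sub_le (N := n + 1) (m := m) ω (hL f)
  have h5 : |∫ σ, f σ ∂ν.toMeasure - (∑ j ∈ Finset.range m, average n f (ω j)) / m|
      ≤ ε / 3 + L f * (2 * ‖f‖) * (1 / ((n : ℝ) + 1)) := by
    rw [h1, h3, ← mul_sub, abs_mul, abs_of_pos (by positivity), inv_mul_le_iff₀ (by positivity)]
    refine h4.trans (le_of_eq ?_)
    push_cast
    field_simp
  have h6 := abs_sub_le (∫ σ, f σ ∂ν.toMeasure) ((∑ j ∈ Finset.range m, average n f (ω j)) / m)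
    (∫ σ, f σ ∂μ.toMeasure)
  have h7 := hn f hf
  linarith

theorem dense_ergodicMeasures [Nonempty Ω] : Dense (ergodicMeasures Ω) := by
  classical
  intro μ
  choose ν hν hclose using fun p : Finset C(Strings Ω, ℝ) × ℕ =>
    exists_ergodic_near μ p.1 (show (0 : ℝ) < 1 / ((p.2 : ℝ) + 1) by positivity)
  refine mem_closure_of_tendsto (f := ν) (b := atTop) (InvMeasure.tendsto_iff.2 fun f => ?_)
    (Eventually.of_forall hν)
  refine Metric.tendsto_nhds.2 fun ε hε => ?_
  obtain ⟨k, hk⟩ := exists_nat_one_div_lt hε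
  filter_upwards [eventually_ge_atTop (({f}, k) : Finset C(Strings Ω, ℝ) × ℕ)] with p hp
  have h1 := hclose p f (hp.1 (Finset.mem_singleton_self f))
  have h2 : 1 / ((p.2 : ℝ) + 1) ≤ 1 / ((k : ℝ) + 1) :=
    one_div_le_one_div_of_le (by positivity) (by
      have : (k : ℝ) ≤ p.2 := by exact_mod_cast hp.2
      linarith)
  rw [Real.dist_eq]
  linarith

/-- The point masses at two constant strings are distinct invariant measures. -/
theorem nontrivial_invMeasure [Nontrivial Ω] : Nontrivial (InvMeasure Ω) := by
  obtain ⟨a, b, hab⟩ := exists_pair_ne Ω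
  obtain ⟨μ, -, hμ⟩ := exists_ergodic_eq_empirical (n := 0) (σ := fun _ => a) rfl
  obtain ⟨ν, -, hν⟩ := exists_ergodic_eq_empirical (n := 0) (σ := fun _ => b) rfl
  refine ⟨μ, ν, fun h => hab ?_⟩
  let f : C(Strings Ω, ℝ) := ⟨fun σ => dist (σ 0) b, by fun_prop⟩
  have h1 : ∫ σ, f σ ∂(empirical 0 fun _ => a).toMeasure
      = ∫ σ, f σ ∂(empirical 0 fun _ => b).toMeasure := by rw [← hμ, ← hν, h]
  rw [integral_empirical, integral_empirical] at h1
  simpa [average_apply, f] using h1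

/-! ### Continuity points and the Γ-regularization -/

/-- At continuity points the functional agrees with `μ ↦ F(μ_S)`, since the two agree on the dense
set of ergodic measures. -/
theorem delta_eq_of_continuousAt [Nonempty Ω] {F : BoundedMeasurable Ω → ℝ} (hF : SigmaNormal F)
    {μ : InvMeasure Ω} (hc : ContinuousAt (Delta F) μ) : Delta F μ = F μ.onS := by
  have : (𝓝[ergodicMeasures Ω] μ).NeBot := mem_closure_iff_nhdsWithin_neBot.1
    (dense_ergodicMeasures μ)
  refine tendsto_nhds_unique (l := 𝓝[ergodicMeasures Ω] μ)
    (hc.tendsto.mono_left nhdsWithin_le_nhds)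
    ((hF.continuous_invMeasure.continuousAt.tendsto.mono_left nhdsWithin_le_nhds).congr' ?_)
  filter_upwards [self_mem_nhdsWithin] with ν hν
  exact (delta_eq_of_ergodic F hν).symm

/-- For a strictly convex functional, every proper mixture of two different measures is a point of
discontinuity, and such mixtures are dense. -/
theorem dense_not_continuousAt_delta [Nontrivial Ω] {F : BoundedMeasurable Ω → ℝ}
    (hconv : ConvexOn ℝ univ F) (hF : SigmaNormal F)
    (hs : IsStrictlyConvex fun μ : InvMeasure Ω => F μ.onS) :
    Dense {μ : InvMeasure Ω | ¬ ContinuousAt (Delta F) μ} := by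
  intro μ
  have := nontrivial_invMeasure (Ω := Ω)
  obtain ⟨ν, hν⟩ := exists_ne μ
  let t : ℕ → unitInterval := fun n =>
    ⟨1 / ((n : ℝ) + 2), by positivity, by
      rw [div_le_one (by positivity)]
      have : (0 : ℝ) ≤ n := n.cast_nonneg
      linarith⟩
  have ht0 : Tendsto (fun n => (t n : ℝ)) atTop (𝓝 0) := by
    have h := (tendsto_one_div_add_atTop_nhds_zero_nat (𝕜 := ℝ)).comp (tendsto_add_atTop_nat 1)
    refine h.congr fun n => ?_
    change 1 / (((n + 1 : ℕ) : ℝ) + 1) = 1 / ((n : ℝ) + 2)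
    push_cast
    ring
  refine mem_closure_of_tendsto (f := fun n => InvMeasure.mix (t n) ν μ) (b := atTop)
    (InvMeasure.tendsto_iff.2 fun f => ?_) (Eventually.of_forall fun n hcont => ?_)
  · simp only [integral_mix]
    have h := (ht0.mul_const (∫ σ, f σ ∂ν.toMeasure)).add
      ((ht0.const_sub 1).mul_const (∫ σ, f σ ∂μ.toMeasure))
    simpa using h
  · have hpos : (0 : ℝ) < t n := by
      change (0 : ℝ) < 1 / ((n : ℝ) + 2)
      positivity
    have hlt : (t n : ℝ) < 1 := by
      change 1 / ((n : ℝ) + 2) < 1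
      rw [div_lt_one (by positivity)]
      have : (0 : ℝ) ≤ n := n.cast_nonneg
      linarith
    have h1 := hs (t n) ν μ hpos hlt hν
    have h2 := delta_eq_of_continuousAt hF hcont
    rw [isAffine_delta hF] at h2
    have h3 := mul_le_mul_of_nonneg_left (le_delta hconv hF ν) hpos.le
    have h4 := mul_le_mul_of_nonneg_left (le_delta hconv hF μ) (sub_nonneg.2 hlt.le)
    simp only at h1
    linarith

theorem isMeagre_not_continuousAt_delta [Nonempty Ω] {F : BoundedMeasurable Ω → ℝ}
    (hconv : ConvexOn ℝ univ F) (hF : SigmaNormal F) :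
    IsMeagre {μ : InvMeasure Ω | ¬ ContinuousAt (Delta F) μ} := by
  refine mem_of_superset (residual_of_dense_Gδ isGδ_ergodicMeasures dense_ergodicMeasures) ?_
  intro ν hν hnot
  exact hnot (continuousAt_delta_of_ergodic hconv hF hν)

theorem continuous_delta_iff [Nonempty Ω] {F : BoundedMeasurable Ω → ℝ} (hF : SigmaNormal F) :
    Continuous (Delta F) ↔ IsAffine fun μ : InvMeasure Ω => F μ.onS := by
  constructor
  · intro hc
    have h : Delta F = fun μ : InvMeasure Ω => F μ.onS :=
      funext fun μ => delta_eq_of_continuousAt hF hc.continuousAt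
    exact h ▸ isAffine_delta hF
  · intro ha
    have h : Delta F = fun μ : InvMeasure Ω => F μ.onS := funext (delta_eq_of_isAffine hF ha)
    rw [h]
    exact hF.continuous_invMeasure

/-- The weak* continuous affine functional `ℓ ↦ ℓ f + c` on `C(Σ)*`. -/
def affineEval (f : C(Strings Ω, ℝ)) (c : ℝ) : WeakDual ℝ C(Strings Ω, ℝ) →ᴬ[ℝ] ℝ where
  toFun ℓ := ℓ f + c
  linear := (topDualPairing ℝ C(Strings Ω, ℝ)).flip f
  map_vadd' ℓ ℓ' := by
    change (ℓ' + ℓ) f + c = ℓ' f + (ℓ f + c)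
    rw [← add_assoc]
    rfl
  cont := (WeakDual.eval_continuous f).add continuous_const

theorem gammaRegularization_delta [Nonempty Ω] {F : BoundedMeasurable Ω → ℝ}
    (hconv : ConvexOn ℝ univ F) (hF : SigmaNormal F) (μ : InvMeasure Ω) :
    gammaRegularization (fun ν => ((Delta F ν : ℝ) : EReal)) μ = ((F μ.onS : ℝ) : EReal) := by
  refine le_antisymm (sSup_le ?_) (le_of_forall_lt fun x hx => ?_)
  · rintro _ ⟨m, hm, rfl⟩
    -- the inequality holds on ergodic measures, and both sides are continuous
    have hclosed : IsClosed {ν : InvMeasure Ω | m ν.toDual ≤ F ν.onS} :=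
      isClosed_le (m.cont.comp InvMeasure.continuous_toDual) hF.continuous_invMeasure
    have hsub : ergodicMeasures Ω ⊆ {ν : InvMeasure Ω | m ν.toDual ≤ F ν.onS} := by
      intro ν hν
      have := EReal.coe_le_coe_iff.1 (hm ν)
      rwa [delta_eq_of_ergodic F hν] at this
    exact EReal.coe_le_coe_iff.2 (hclosed.closure_subset_iff.2 hsub (dense_ergodicMeasures μ))
  · obtain ⟨r, hxr, hr⟩ := EReal.lt_iff_exists_real_btwn.1 hx
    rw [EReal.coe_lt_coe_iff] at hr
    obtain ⟨f, c, hle, hlt⟩ := exists_affine_minorant hF.continuous_invMeasure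
      (isConvex_onS hconv) μ (sub_pos.2 hr)
    refine lt_of_lt_of_le (hxr.trans (EReal.coe_lt_coe_iff.2 ?_))
      (le_sSup ⟨affineEval f c, fun ν => EReal.coe_le_coe_iff.2 ?_, rfl⟩)
    · rw [sub_sub_cancel] at hlt
      exact hlt
    · exact (hle ν).trans (le_delta hconv hF ν)

end DeltaFunctional

end

theorem mainTheorem7 {Ω : Type*} [MetricSpace Ω] [CompactSpace Ω] [Nontrivial Ω]
    [MeasurableSpace Ω] [BorelSpace Ω]
    (F : DeltaFunctional.BoundedMeasurable Ω → ℝ)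
    (hconv : ConvexOn ℝ Set.univ F) (hnormal : DeltaFunctional.SigmaNormal F) :
    -- the Choquet measures defining `Δ^F` exist and are unique
    (∀ μ : DeltaFunctional.InvMeasure Ω,
      ∃! ξ : MeasureTheory.Measure (DeltaFunctional.InvMeasure Ω),
        DeltaFunctional.IsChoquetMeasure μ ξ) ∧
    -- (i)
    (UpperSemicontinuous (DeltaFunctional.Delta F) ∧
      DeltaFunctional.IsAffine (DeltaFunctional.Delta F)) ∧
    -- (ii)
    ((Continuous (DeltaFunctional.Delta F) ↔
        DeltaFunctional.IsAffine (fun μ : DeltaFunctional.InvMeasure Ω => F μ.onS)) ∧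
      (Continuous (DeltaFunctional.Delta F) →
        ∃ f : C(DeltaFunctional.Strings Ω, ℝ), ∀ μ : DeltaFunctional.InvMeasure Ω,
          DeltaFunctional.Delta F μ = ∫ σ, f σ ∂μ.toMeasure)) ∧
    -- (iii)
    (DeltaFunctional.IsStrictlyConvex (fun μ : DeltaFunctional.InvMeasure Ω => F μ.onS) →
      Dense {μ : DeltaFunctional.InvMeasure Ω | ¬ ContinuousAt (DeltaFunctional.Delta F) μ}) ∧
    -- (iv)
    (IsGδ (DeltaFunctional.ergodicMeasures Ω) ∧ Dense (DeltaFunctional.ergodicMeasures Ω) ∧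
      (∀ ν ∈ DeltaFunctional.ergodicMeasures Ω, ContinuousAt (DeltaFunctional.Delta F) ν) ∧
      IsMeagre {μ : DeltaFunctional.InvMeasure Ω |
        ¬ ContinuousAt (DeltaFunctional.Delta F) μ}) ∧
    -- (v)
    (Continuous (fun μ : DeltaFunctional.InvMeasure Ω => F μ.onS) ∧
      DeltaFunctional.IsConvex (fun μ : DeltaFunctional.InvMeasure Ω => F μ.onS) ∧
      ∀ μ : DeltaFunctional.InvMeasure Ω,
        DeltaFunctional.gammaRegularization
            (fun ν => ((DeltaFunctional.Delta F ν : ℝ) : EReal)) μ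
          = ((F μ.onS : ℝ) : EReal)) := by
  have : Nonempty Ω := inferInstance
  refine ⟨fun μ => ?_, ⟨?_, ?_⟩, ⟨?_, ?_⟩, ?_, ⟨?_, ?_, fun ν hν => ?_, ?_⟩, ?_, ?_, ?_⟩
  · obtain ⟨ξ, hξ⟩ := DeltaFunctional.exists_isChoquetMeasure μ
    exact ⟨ξ, hξ, fun ξ' hξ' => hξ'.unique hξ⟩
  · exact DeltaFunctional.upperSemicontinuous_delta hconv hnormal
  · exact DeltaFunctional.isAffine_delta hnormal
  · exact DeltaFunctional.continuous_delta_iff hnormal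
  · exact DeltaFunctional.exists_integral_eq_delta hconv hnormal
  · exact DeltaFunctional.dense_not_continuousAt_delta hconv hnormal
  · exact DeltaFunctional.isGδ_ergodicMeasures
  · exact DeltaFunctional.dense_ergodicMeasures
  · exact DeltaFunctional.continuousAt_delta_of_ergodic hconv hnormal hν
  · exact DeltaFunctional.isMeagre_not_continuousAt_delta hconv hnormal
  · exact hnormal.continuous_invMeasure
  · exact DeltaFunctional.isConvex_onS hconv
  · exact DeltaFunctional.gammaRegularization_delta hconv hnormal
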